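/- **Setting.** Let $\mathbb{H}$ be the quaternions with imaginary units $e_1,e_2,e_3$ and let $L^2(\mathbb{R}^3,\mathbb{H})$ be the two-sided quaternionic Banach space of square-integrable $\mathbb{H}$-valued functions on $\mathbb{R}^3$. Operators are right $\mathbb{H}$-linear, and compositions and sums of operators carry their natural domains. - $\nabla=e_1\partial_{x_1}+e_2\partial_{x_2}+e_3\partial_{x_3}$ and $-\Delta$ are the operators on $L^2(\mathbb{R}^3,\mathbb{H})$ in the sense of distributions with maximal domains; for $\beta\in\mathbb{R}$, $(-\Delta)^{\beta}$ acts componentwise as the Fourier multiplier $|\xi|^{2\beta}$ with its maximal domain (where $|\xi|^2$ is the symbol of $-\Delta$). - For a right-linear operator $T$ and $s\in\mathbb{H}$ put $\mathcal{Q}_s(T)=T^2-2\operatorname{Re}(s)T+|s|^2$ with domain $\mathcal{D}(T^2)$; $s$ is in the $S$-resolvent set $\rho_S(T)$ if $\mathcal{Q}_s(T)$ has a bounded everywhere defined inverse, and then $S_L^{-1}(s,T)=\mathcal{Q}_s(T)^{-1}\overline{s}-T\mathcal{Q}_s(T)^{-1}$, where quaternions act by multiplication from the left. - For $s\in\mathbb{H}\setminus(-\infty,0]$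 and $\beta\in\mathbb{R}$ put $s^{\beta}=\exp\big(\beta(\ln|s|+I_s\arccos(\operatorname{Re}(s)/|s|))\big)$, where $I_s$ is the normalized imaginary part of $s$. - Let $\alpha\in(0,1)$ and let $I\in\mathbb{H}$ be any imaginary unit, i.e. $I^2=-1$ (for instance $I=e_1$). With $ds_I=-I\,ds$, define $$f_\alpha(\nabla)v=\frac1{2\pi}\int_{-I\mathbb{R}}S_L^{-1}(s,\nabla)\,ds_I\,s^{\alpha-1}\,\nabla v=\frac1{2\pi}\int_{-\infty}^{+\infty}S_L^{-1}(-It,\nabla)\,(-I)^2(-It)^{\alpha-1}\,\nabla v\,dt$$ for those $v\in\mathcal{D}(\nabla)$ for which the integral converges absolutely in $L^2(\mathbb{R}^3,\mathbb{H})$. - If $A=A_0+\sum_{\ell=1}^3 e_\ell A_\ell$ with scalar operators $A_\ell$ (operators on real-valued functions, extended componentwise), its vector part is $\operatorname{Vec}A=\sum_{\ell=1}^3e_\ell A_\ell$. Thus $(\operatorname{Vec}A)v=\sum_{k=0}^3\operatorname{Im}(Av_k)\,e_k$ for $v=\sum_{k=0}^3v_ke_k$ with $v_k$ real-valued and $e_0=1$.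 **Theorem.** For every $\alpha\in(0,1)$ and every $I$ as above: 1. $-It\in\rho_S(\nabla)$ for all real $t\neq0$, and the integral converges for every $v\in\mathcal{D}(\nabla)$, so that $f_\alpha(\nabla)$ is a right-linear operator with domain $\mathcal{D}(\nabla)$. 2. $f_\alpha(\nabla)$ can be extended to a closed right-linear operator on $L^2(\mathbb{R}^3,\mathbb{H})$. 3. $\nabla^2=-\Delta$, including equality of domains, and for every $v\in\mathcal{D}(\nabla^2)=\mathcal{D}(-\Delta)$ the following right-hand side is defined and $$f_\alpha(\nabla)v=(-\Delta)^{\frac{\alpha}{2}-1}\Big[\tfrac12(-\Delta)^{\frac12}+\tfrac12\nabla\Big]\nabla v .$$ 4. For every $v=\sum_{k=0}^3v_ke_k\in\mathcal{D}(-\Delta)$, the real components $v_k$ lie in $\mathcal{D}(f_\alpha(\nabla))$, $\nabla v\in\mathcal{D}\big((-\Delta)^{\frac{\alpha-1}2}\big)$, and $$\operatorname{Vec}f_\alpha(\nabla)\,v=\tfrac12(-\Delta)^{\frac{\alpha-1}{2}}\nabla v .$$ -/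

import Mathlib

open MeasureTheory
open scoped Quaternion SchwartzMap LineDeriv Laplacian FourierTransform MulOpposite

noncomputable section

namespace QNabla

/-! ### The quaternionic space `L²(ℝ³, ℍ)` -/

/-- Euclidean space `ℝ³`. -/
abbrev E3 := EuclideanSpace ℝ (Fin 3)

/-- `L²(ℝ³, ℍ)`. It is a two-sided quaternionic Banach space: `a • v` with `a : ℍ` is
multiplication by `a` from the left, `op a • v` is multiplication by `a` from the right. -/
abbrev L2H := Lp ℍ[ℝ] 2 (volume : Measure E3)

/-- A right-linear quaternionic operator on `L²(ℝ³, ℍ)` that is defined on a right-linear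
subspace of `L²(ℝ³, ℍ)`, its domain. -/
abbrev Op := L2H →ₗ.[ℍ[ℝ]ᵐᵒᵖ] L2H

/-- The imaginary units `e₁, e₂, e₃`. -/
def e : Fin 3 → ℍ[ℝ] := ![⟨0, 1, 0, 0⟩, ⟨0, 0, 1, 0⟩, ⟨0, 0, 0, 1⟩]

/-- The basis `1, e₁, e₂, e₃` of `ℍ`. -/
def basisH : Fin 4 → ℍ[ℝ] := ![1, e 0, e 1, e 2]

/-- The real coordinates of a quaternion with respect to `1, e₁, e₂, e₃`. -/
def coord (k : Fin 4) : ℍ[ℝ] →L[ℝ] ℝ :=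
  (EuclideanSpace.proj k : EuclideanSpace ℝ (Fin 4) →L[ℝ] ℝ) ∘L
    (Quaternion.linearIsometryEquivTuple.toContinuousLinearEquiv :
      ℍ[ℝ] →L[ℝ] EuclideanSpace ℝ (Fin 4))

/-- The inclusion of `ℝ` into `ℍ`. -/
def realIncl : ℝ →L[ℝ] ℍ[ℝ] := ContinuousLinearMap.toSpanSingleton ℝ (1 : ℍ[ℝ])

/-- The component `v_k` of `v = v₀ + v₁ e₁ + v₂ e₂ + v₃ e₃`, considered as a real-valued element
of `L²(ℝ³, ℍ)`. -/
def realComp (k : Fin 4) (v : L2H) : L2H := (realIncl ∘L coord k).compLp v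

/-- The component `v_k` of `v = v₀ + v₁ e₁ + v₂ e₂ + v₃ e₃`, considered as an element of
`L²(ℝ³, ℂ)`. -/
def cplxComp (k : Fin 4) (v : L2H) : Lp ℂ 2 (volume : Measure E3) :=
  (Complex.ofRealCLM ∘L coord k).compLp v

/-- The pointwise imaginary part (vector part) of an `ℍ`-valued function. -/
def imPart (v : L2H) : L2H := (ContinuousLinearMap.id ℝ ℍ[ℝ] - realIncl ∘L coord 0).compLp v

/-! ### The nabla operator and the Laplacian -/

/-- The pairing `∫ φ v` of `v ∈ L²(ℝ³, ℍ)` with a real test function. -/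
def pairing (φ : 𝓢(E3, ℝ)) (v : L2H) : ℍ[ℝ] := ∫ x, φ x • v x

theorem integrable_pairing (φ : 𝓢(E3, ℝ)) (v : L2H) :
    Integrable (fun x => φ x • v x) (volume : Measure E3) :=
  memLp_one_iff_integrable.1 ((Lp.memLp v).smul (φ.memLp 2 volume) (r := 1))

theorem pairing_add (φ : 𝓢(E3, ℝ)) (v w : L2H) :
    pairing φ (v + w) = pairing φ v + pairing φ w := by
  unfold pairing
  rw [← integral_add (integrable_pairing φ v) (integrable_pairing φ w)]
  refine integral_congr_ae ?_
  filter_upwards [Lp.coeFn_add v w] with x hx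
  rw [hx, Pi.add_apply, smul_add]

theorem pairing_smul (φ : 𝓢(E3, ℝ)) (q : ℍ[ℝ]ᵐᵒᵖ) (v : L2H) :
    pairing φ (q • v) = pairing φ v * q.unop := by
  unfold pairing
  have h := ((ContinuousLinearMap.mul ℝ ℍ[ℝ]).flip q.unop).integral_comp_comm
    (integrable_pairing φ v)
  simp only [ContinuousLinearMap.flip_apply, ContinuousLinearMap.mul_apply'] at h
  rw [← h]
  refine integral_congr_ae ?_
  filter_upwards [Lp.coeFn_smul q v] with x hx
  rw [hx, Pi.smul_apply, smul_mul_assoc]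
  rfl

theorem pairing_zero (φ : 𝓢(E3, ℝ)) : pairing φ 0 = 0 := by
  have := pairing_add φ 0 0
  simpa using this

theorem eq_zero_of_pairing {w : L2H} (h : ∀ φ, pairing φ w = 0) : w = 0 := by
  rw [Lp.eq_zero_iff_ae_eq_zero]
  refine ae_eq_zero_of_integral_contDiff_smul_eq_zero
    ((Lp.memLp w).locallyIntegrable (by norm_num)) ?_
  intro g hg hs
  exact h (hs.toSchwartzMap hg)

/-- The `i`-th standard basis vector of `ℝ³`. -/
def ee (i : Fin 3) : E3 := EuclideanSpace.single i (1 : ℝ)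

/-- The graph of `∇ = e₁ ∂₁ + e₂ ∂₂ + e₃ ∂₃`: the pairs `(v, w)` in `L²(ℝ³, ℍ)` such that
`w = e₁ ∂₁ v + e₂ ∂₂ v + e₃ ∂₃ v` in the sense of distributions. -/
def nablaGraph : Submodule ℍ[ℝ]ᵐᵒᵖ (L2H × L2H) where
  carrier := {p | ∀ φ : 𝓢(E3, ℝ), ∑ i, e i * pairing (∂_{ee i} φ) p.1 = -pairing φ p.2}
  add_mem' {p q} hp hq φ := by
    simp only [Prod.fst_add, Prod.snd_add, pairing_add, mul_add, Finset.sum_add_distrib, hp φ,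
      hq φ]
    abel
  zero_mem' φ := by simp [pairing_zero]
  smul_mem' c p hp φ := by
    simp only [Prod.smul_fst, Prod.smul_snd, pairing_smul, ← mul_assoc, ← Finset.sum_mul, hp φ,
      neg_mul]

/-- The nabla operator `∇ = e₁ ∂₁ + e₂ ∂₂ + e₃ ∂₃` on `L²(ℝ³, ℍ)` with its maximal domain. -/
def nabla : Op := nablaGraph.toLinearPMap

theorem graph_nabla : nabla.graph = nablaGraph := by
  refine Submodule.toLinearPMap_graph_eq _ ?_
  rintro ⟨v, w⟩ h rfl
  refine eq_zero_of_pairing fun φ => ?_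
  have := h φ
  simpa [pairing_zero] using this.symm

/-- The graph of `-Δ`: the pairs `(v, w)` in `L²(ℝ³, ℍ)` such that `w = -Δ v` in the sense of
distributions. -/
def negLaplacianGraph : Submodule ℍ[ℝ]ᵐᵒᵖ (L2H × L2H) where
  carrier := {p | ∀ φ : 𝓢(E3, ℝ), pairing (Δ φ) p.1 = -pairing φ p.2}
  add_mem' {p q} hp hq φ := by
    simp only [Prod.fst_add, Prod.snd_add, pairing_add, hp φ, hq φ]
    abel
  zero_mem' φ := by simp [pairing_zero]
  smul_mem' c p hp φ := by
    simp only [Prod.smul_fst, Prod.smul_snd, pairing_smul, hp φ, neg_mul]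

/-- The negative Laplacian `-Δ` on `L²(ℝ³, ℍ)` with its maximal domain. -/
def negLaplacian : Op := negLaplacianGraph.toLinearPMap

theorem graph_negLaplacian : negLaplacian.graph = negLaplacianGraph := by
  refine Submodule.toLinearPMap_graph_eq _ ?_
  rintro ⟨v, w⟩ h rfl
  refine eq_zero_of_pairing fun φ => ?_
  have := h φ
  simpa [pairing_zero] using this.symm

/-! ### Fractional powers of the negative Laplacian -/

theorem cplxComp_add (k : Fin 4) (v w : L2H) :
    cplxComp k (v + w) = cplxComp k v + cplxComp k w :=
  map_add ((Complex.ofRealCLM ∘L coord k).compLpₗ 2 (volume : Measure E3)) v w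

theorem coord_basisH (x : ℍ[ℝ]) : x = ∑ j, coord j x • basisH j := by
  ext <;> simp only [Fin.sum_univ_four, coord, basisH, e]
  · change x.re = x.re * 1 + x.imI * 0 + x.imJ * 0 + x.imK * 0
    ring
  · change x.imI = x.re * 0 + x.imI * 1 + x.imJ * 0 + x.imK * 0
    ring
  · change x.imJ = x.re * 0 + x.imI * 0 + x.imJ * 1 + x.imK * 0
    ring
  · change x.imK = x.re * 0 + x.imI * 0 + x.imJ * 0 + x.imK * 1
    ring

theorem cplxComp_smul (k : Fin 4) (q : ℍ[ℝ]ᵐᵒᵖ) (v : L2H) :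
    cplxComp k (q • v) =
      ∑ j, ((coord k (basisH j * q.unop) : ℝ) : ℂ) • cplxComp j v := by
  have key : ∀ x : ℍ[ℝ], ((coord k (q • x) : ℝ) : ℂ) =
      ∑ j, ((coord k (basisH j * q.unop) : ℝ) : ℂ) * ((coord j x : ℝ) : ℂ) := by
    intro x
    have : q • x = ∑ j, coord j x • (basisH j * q.unop) := by
      conv_lhs => rw [coord_basisH x]
      rw [Finset.smul_sum]
      refine Finset.sum_congr rfl fun j _ => ?_
      rw [smul_comm]
      rfl
    rw [this, map_sum]
    push_cast
    refine Finset.sum_congr rfl fun j _ => ?_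
    rw [map_smul, smul_eq_mul]
    push_cast
    ring
  have hL : ∀ (j : Fin 4) (w : L2H), cplxComp j w =ᵐ[volume] fun x => ((coord j (w x) : ℝ) : ℂ) :=
    fun j w => (Complex.ofRealCLM ∘L coord j).coeFn_compLp w
  refine Lp.ext ?_
  rw [Fin.sum_univ_four]
  filter_upwards [hL k (q • v), hL 0 v, hL 1 v, hL 2 v, hL 3 v, Lp.coeFn_smul q v,
    Lp.coeFn_add (((coord k (basisH 0 * q.unop) : ℝ) : ℂ) • cplxComp 0 v
      + ((coord k (basisH 1 * q.unop) : ℝ) : ℂ) • cplxComp 1 v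
      + ((coord k (basisH 2 * q.unop) : ℝ) : ℂ) • cplxComp 2 v)
      (((coord k (basisH 3 * q.unop) : ℝ) : ℂ) • cplxComp 3 v),
    Lp.coeFn_add (((coord k (basisH 0 * q.unop) : ℝ) : ℂ) • cplxComp 0 v
      + ((coord k (basisH 1 * q.unop) : ℝ) : ℂ) • cplxComp 1 v)
      (((coord k (basisH 2 * q.unop) : ℝ) : ℂ) • cplxComp 2 v),
    Lp.coeFn_add (((coord k (basisH 0 * q.unop) : ℝ) : ℂ) • cplxComp 0 v)
      (((coord k (basisH 1 * q.unop) : ℝ) : ℂ) • cplxComp 1 v),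
    Lp.coeFn_smul ((coord k (basisH 0 * q.unop) : ℝ) : ℂ) (cplxComp 0 v),
    Lp.coeFn_smul ((coord k (basisH 1 * q.unop) : ℝ) : ℂ) (cplxComp 1 v),
    Lp.coeFn_smul ((coord k (basisH 2 * q.unop) : ℝ) : ℂ) (cplxComp 2 v),
    Lp.coeFn_smul ((coord k (basisH 3 * q.unop) : ℝ) : ℂ) (cplxComp 3 v)]
    with x h1 h20 h21 h22 h23 h3 ha hb hc h0 h1' h2' h3'
  rw [h1, ha, Pi.add_apply, hb, Pi.add_apply, hc, Pi.add_apply, h0, h1', h2', h3', h3]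
  simp only [Pi.smul_apply, smul_eq_mul, h20, h21, h22, h23]
  rw [key, Fin.sum_univ_four]

/-- The graph of multiplication by the real function `m` on `L²(ℝ³, ℂ)`. -/
def mulGraph (m : E3 → ℝ) :
    Submodule ℂ (Lp ℂ 2 (volume : Measure E3) × Lp ℂ 2 (volume : Measure E3)) where
  carrier := {p | p.2 =ᵐ[volume] fun ξ => (m ξ : ℂ) * p.1 ξ}
  add_mem' {p q} hp hq := by
    simp only [Set.mem_ofPred_eq, Prod.fst_add, Prod.snd_add] at hp hq ⊢
    filter_upwards [hp, hq, Lp.coeFn_add p.1 q.1, Lp.coeFn_add p.2 q.2] with ξ h1 h2 h3 h4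
    rw [h3, h4, Pi.add_apply, Pi.add_apply, h1, h2, mul_add]
  zero_mem' := by
    simp only [Set.mem_ofPred_eq, Prod.fst_zero, Prod.snd_zero]
    filter_upwards [Lp.coeFn_zero ℂ 2 (volume : Measure E3)] with ξ h
    simp
  smul_mem' c p hp := by
    simp only [Set.mem_ofPred_eq, Prod.smul_fst, Prod.smul_snd] at hp ⊢
    filter_upwards [hp, Lp.coeFn_smul c p.1, Lp.coeFn_smul c p.2] with ξ h1 h2 h3
    rw [h2, h3, Pi.smul_apply, Pi.smul_apply, h1, smul_eq_mul, smul_eq_mul]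
    ring

/-- The graph of `(-Δ)^β`: the pairs `(v, w)` in `L²(ℝ³, ℍ)` such that, componentwise,
`ŵ(ξ) = (2π|ξ|)^{2β} v̂(ξ)` for almost every `ξ`, where
`v̂(ξ) = ∫ v(x) exp(-2πi x·ξ) dx` is the Fourier transform on `L²`. -/
def fracLaplacianGraph (β : ℝ) : Submodule ℍ[ℝ]ᵐᵒᵖ (L2H × L2H) where
  carrier := {p | ∀ k, (𝓕 (cplxComp k p.1), 𝓕 (cplxComp k p.2)) ∈
    mulGraph fun ξ => (2 * Real.pi * ‖ξ‖) ^ (2 * β)}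
  add_mem' {p q} hp hq k := by
    have := Submodule.add_mem _ (hp k) (hq k)
    simpa only [Prod.fst_add, Prod.snd_add, cplxComp_add, FourierTransform.fourier_add,
      Prod.mk_add_mk] using this
  zero_mem' k := by
    have h0 : cplxComp k 0 = 0 := by
      have := cplxComp_add k 0 0
      simpa using this
    have h1 : 𝓕 (0 : Lp ℂ 2 (volume : Measure E3)) = 0 :=
      map_zero (Lp.fourierTransformₗᵢ E3 ℂ)
    simp only [Prod.fst_zero, Prod.snd_zero, h0, h1]
    exact Submodule.zero_mem _
  smul_mem' c p hp k := by
    have h1 : ∀ v : L2H, 𝓕 (cplxComp k (c • v)) =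
        ∑ j, ((coord k (basisH j * c.unop) : ℝ) : ℂ) • 𝓕 (cplxComp j v) := by
      intro v
      rw [cplxComp_smul]
      have := map_sum (Lp.fourierTransformₗᵢ E3 ℂ)
        (fun j => ((coord k (basisH j * c.unop) : ℝ) : ℂ) • cplxComp j v) Finset.univ
      simp only [map_smul] at this
      exact this
    have h2 := Submodule.sum_mem (mulGraph fun ξ => (2 * Real.pi * ‖ξ‖) ^ (2 * β))
      (t := Finset.univ)
      (f := fun j => ((coord k (basisH j * c.unop) : ℝ) : ℂ) •
        (𝓕 (cplxComp j p.1), 𝓕 (cplxComp j p.2)))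
      fun j _ => Submodule.smul_mem _ _ (hp j)
    simp only [Prod.smul_fst, Prod.smul_snd, h1]
    convert h2 using 1
    ext1 <;> simp [Prod.fst_sum, Prod.snd_sum]

/-- The fractional power `(-Δ)^β`, `β ∈ ℝ`, of the negative Laplacian on `L²(ℝ³, ℍ)`, acting
componentwise, with its maximal domain. -/
def fracLaplacian (β : ℝ) : Op := (fracLaplacianGraph β).toLinearPMap

theorem eq_zero_of_cplxComp {w : L2H} (h : ∀ k, cplxComp k w = 0) : w = 0 := by
  rw [Lp.eq_zero_iff_ae_eq_zero]
  have hL : ∀ j : Fin 4, ∀ᵐ x ∂(volume : Measure E3), coord j (w x) = 0 := by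
    intro j
    have h0 := h j
    rw [Lp.eq_zero_iff_ae_eq_zero] at h0
    filter_upwards [h0, (Complex.ofRealCLM ∘L coord j).coeFn_compLp w] with x h1 h2
    have h3 : ((coord j (w x) : ℝ) : ℂ) = 0 := h2.symm.trans h1
    exact_mod_cast h3
  filter_upwards [hL 0, hL 1, hL 2, hL 3] with x h0 h1 h2 h3
  rw [coord_basisH (w x), Fin.sum_univ_four, h0, h1, h2, h3]
  simp

theorem graph_fracLaplacian (β : ℝ) : (fracLaplacian β).graph = fracLaplacianGraph β := by
  refine Submodule.toLinearPMap_graph_eq _ ?_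
  rintro ⟨v, w⟩ h rfl
  refine eq_zero_of_cplxComp fun k => ?_
  have h0 : cplxComp k 0 = 0 := by
    have := cplxComp_add k 0 0
    simpa using this
  have hk : ⇑(𝓕 (cplxComp k w) : Lp ℂ 2 (volume : Measure E3)) =ᵐ[volume] fun ξ : E3 =>
      (((2 * Real.pi * ‖ξ‖) ^ (2 * β) : ℝ) : ℂ) *
        (𝓕 (cplxComp k (0 : L2H)) : Lp ℂ 2 (volume : Measure E3)) ξ := h k
  have h1 : 𝓕 (0 : Lp ℂ 2 (volume : Measure E3)) = 0 :=
    map_zero (Lp.fourierTransformₗᵢ E3 ℂ)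
  rw [h0, h1] at hk
  have h2 : (𝓕 (cplxComp k w) : Lp ℂ 2 (volume : Measure E3)) = 0 := by
    rw [Lp.eq_zero_iff_ae_eq_zero]
    filter_upwards [hk, Lp.coeFn_zero ℂ 2 (volume : Measure E3)] with ξ h3 h4
    rw [h3, h4]
    simp
  exact (Lp.fourierTransformₗᵢ E3 ℂ).map_eq_zero_iff.1 h2

/-! ### Operators with domains -/

section Composition

variable {R V : Type*} [Ring R] [AddCommGroup V] [Module R V]

/-- The natural domain `{v ∈ 𝒟(B) | B v ∈ 𝒟(A)}` of the composition `A B`. -/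
def opCompDomain (A B : V →ₗ.[R] V) : Submodule R V where
  carrier := {v | ∃ h : v ∈ B.domain, B ⟨v, h⟩ ∈ A.domain}
  add_mem' := by
    rintro v w ⟨hv, hv'⟩ ⟨hw, hw'⟩
    refine ⟨add_mem hv hw, ?_⟩
    have h : B ⟨v + w, add_mem hv hw⟩ = B ⟨v, hv⟩ + B ⟨w, hw⟩ := B.map_add ⟨v, hv⟩ ⟨w, hw⟩
    rw [h]
    exact add_mem hv' hw'
  zero_mem' := by
    refine ⟨zero_mem _, ?_⟩
    have h : B ⟨0, zero_mem _⟩ = 0 := B.map_zero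
    rw [h]
    exact zero_mem _
  smul_mem' := by
    rintro c v ⟨hv, hv'⟩
    refine ⟨Submodule.smul_mem _ c hv, ?_⟩
    have h : B ⟨c • v, Submodule.smul_mem _ c hv⟩ = c • B ⟨v, hv⟩ := B.map_smul c ⟨v, hv⟩
    rw [h]
    exact Submodule.smul_mem _ c hv'

/-- The composition `A B` of operators with its natural domain. -/
def opComp (A B : V →ₗ.[R] V) : V →ₗ.[R] V where
  domain := opCompDomain A B
  toFun :=
    { toFun := fun v => A ⟨B ⟨v.1, v.2.fst⟩, v.2.snd⟩
      map_add' := by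
        intro v w
        rw [← A.map_add]
        congr 1
        ext1
        exact B.map_add ⟨v.1, v.2.fst⟩ ⟨w.1, w.2.fst⟩
      map_smul' := by
        intro c v
        rw [RingHom.id_apply, ← A.map_smul]
        congr 1
        ext1
        exact B.map_smul c ⟨v.1, v.2.fst⟩ }

end Composition

/-- The identity operator, defined everywhere. -/
def idOp : Op := LinearMap.toPMap LinearMap.id ⊤

open Classical in
/-- The value `A v`, with the convention that it is `0` if `v` is not in the domain of `A`. -/
def applyOrZero (A : Op) (v : L2H) : L2H := if h : v ∈ A.domain then A ⟨v, h⟩ else 0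

/-- The vector part `Vec A = e₁ A₁ + e₂ A₂ + e₃ A₃` of an operator
`A = A₀ + e₁ A₁ + e₂ A₂ + e₃ A₃` whose components `A_ℓ` are scalar operators, i.e. operators on
real-valued functions that are extended componentwise to `ℍ`-valued functions. For real-valued `u`
one has `(Vec A) u = Im (A u)`, and hence `(Vec A) v = ∑_k Im (A v_k) e_k` for `v = ∑_k v_k e_k`
with real-valued `v_k` and `e₀ = 1`. -/
def vecPart (A : Op) (v : L2H) : L2H :=
  ∑ k, MulOpposite.op (basisH k) • imPart (applyOrZero A (realComp k v))

/-! ### The `S`-resolvent -/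

/-- `𝒬_s(T) = T² - 2 Re(s) T + |s|²` with domain `𝒟(T²)`. -/
def Q (s : ℍ[ℝ]) (T : Op) : Op :=
  opComp T T - (2 * s.re) • T + (‖s‖ ^ 2) • idOp

/-- `B` is a bounded inverse `𝒬_s(T)⁻¹` of `𝒬_s(T)`. -/
def IsPseudoResolvent (s : ℍ[ℝ]) (T : Op) (B : L2H →L[ℍ[ℝ]ᵐᵒᵖ] L2H) : Prop :=
  (∀ v, ∃ h : B v ∈ (Q s T).domain, Q s T ⟨B v, h⟩ = v) ∧
    ∀ u : (Q s T).domain, B (Q s T u) = u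

/-- The `S`-resolvent set `ρ_S(T)`. -/
def sResolventSet (T : Op) : Set ℍ[ℝ] := {s | ∃ B, IsPseudoResolvent s T B}

open Classical in
/-- The pseudo-resolvent `𝒬_s(T)⁻¹` for `s ∈ ρ_S(T)` (and `0` for other `s`). -/
def pseudoResolvent (s : ℍ[ℝ]) (T : Op) : L2H →L[ℍ[ℝ]ᵐᵒᵖ] L2H :=
  if h : ∃ B, IsPseudoResolvent s T B then h.choose else 0

theorem pseudoResolvent_mem (s : ℍ[ℝ]) (T : Op) (v : L2H) :
    pseudoResolvent s T v ∈ T.domain := by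
  unfold pseudoResolvent
  split_ifs with h
  · obtain ⟨h1, -⟩ := h.choose_spec.1 v
    exact h1.1.1.fst
  · exact zero_mem _

/-- The left `S`-resolvent operator `S_L⁻¹(s, T) = 𝒬_s(T)⁻¹ s̄ - T 𝒬_s(T)⁻¹` for
`s ∈ ρ_S(T)`. -/
def leftSResolvent (s : ℍ[ℝ]) (T : Op) : L2H →ₗ[ℍ[ℝ]ᵐᵒᵖ] L2H :=
  (pseudoResolvent s T).toLinearMap ∘ₗ DistribSMul.toLinearMap ℍ[ℝ]ᵐᵒᵖ L2H (star s) -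
    T.toFun ∘ₗ (pseudoResolvent s T).toLinearMap.codRestrict T.domain (pseudoResolvent_mem s T)

/-! ### Fractional powers of quaternions and the operator `f_α(∇)` -/

/-- The logarithm `log s = ln |s| + I_s arg(s)` of `s ∈ ℍ \ (-∞, 0]`, where
`arg(s) = arccos(s₀ / |s|)` and `I_s` is the normalized imaginary part of `s`. -/
def qlog (s : ℍ[ℝ]) : ℍ[ℝ] :=
  (Real.log ‖s‖ : ℍ[ℝ]) + Real.arccos (s.re / ‖s‖) • (‖s.im‖⁻¹ • s.im)

/-- The fractional power `s^β = exp(β log s)` of `s ∈ ℍ \ (-∞, 0]`. -/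
def qpow (s : ℍ[ℝ]) (β : ℝ) : ℍ[ℝ] := NormedSpace.exp (β • qlog s)

/-- The integrand of `∫_{-Iℝ} S_L⁻¹(s, ∇) ds_I s^{α-1} ∇ v` in the parametrization
`s(t) = -I t`, `t ∈ ℝ`, of the path, so that `ds_I = -I ds = (-I) (-I) dt`. -/
def fAlphaIntegrand (α : ℝ) (I : ℍ[ℝ]) (v : nabla.domain) (t : ℝ) : L2H :=
  leftSResolvent (-(t • I)) nabla
    (((-I) * (-I) * qpow (-(t • I)) (α - 1)) • nabla v)

theorem fAlphaIntegrand_add (α : ℝ) (I : ℍ[ℝ]) (v w : nabla.domain) :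
    fAlphaIntegrand α I (v + w) = fAlphaIntegrand α I v + fAlphaIntegrand α I w := by
  funext t
  simp only [fAlphaIntegrand, LinearPMap.map_add, smul_add, map_add, Pi.add_apply]

theorem fAlphaIntegrand_smul (α : ℝ) (I : ℍ[ℝ]) (c : ℍ[ℝ]ᵐᵒᵖ) (v : nabla.domain) :
    fAlphaIntegrand α I (c • v) = fun t => c • fAlphaIntegrand α I v t := by
  funext t
  simp only [fAlphaIntegrand, LinearPMap.map_smul]
  rw [smul_comm, map_smul]

/-- Multiplication by a quaternion from the right on `L²(ℝ³, ℍ)`. -/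
def rightMul (c : ℍ[ℝ]ᵐᵒᵖ) : L2H →L[ℝ] L2H :=
  ⟨DistribSMul.toLinearMap ℝ L2H c, continuous_const_smul c⟩

/-- The domain of `f_α(∇)`: all `v ∈ 𝒟(∇)` for which the integral
`∫_{-Iℝ} S_L⁻¹(s, ∇) ds_I s^{α-1} ∇ v` converges (as a Bochner integral in `L²(ℝ³, ℍ)`). -/
def fAlphaDomain (α : ℝ) (I : ℍ[ℝ]) : Submodule ℍ[ℝ]ᵐᵒᵖ L2H where
  carrier := {v | ∃ h : v ∈ nabla.domain, Integrable (fAlphaIntegrand α I ⟨v, h⟩) volume}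
  add_mem' := by
    rintro v w ⟨hv, hv'⟩ ⟨hw, hw'⟩
    refine ⟨add_mem hv hw, ?_⟩
    have := hv'.add hw'
    rwa [← fAlphaIntegrand_add] at this
  zero_mem' := by
    refine ⟨zero_mem _, ?_⟩
    have h := fAlphaIntegrand_smul α I 0 0
    simp only [zero_smul] at h
    have h' : fAlphaIntegrand α I ⟨0, zero_mem _⟩ = fun _ => 0 := h
    rw [h']
    exact integrable_zero _ _ _
  smul_mem' := by
    rintro c v ⟨hv, hv'⟩
    refine ⟨Submodule.smul_mem _ c hv, ?_⟩
    have h := (rightMul c).integrable_comp hv'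
    have h' := fAlphaIntegrand_smul α I c ⟨v, hv⟩
    have h'' : fAlphaIntegrand α I ⟨c • v, Submodule.smul_mem _ c hv⟩ =
      fun t => rightMul c (fAlphaIntegrand α I ⟨v, hv⟩ t) := h'
    rw [h'']
    exact h

/-- The value `(1 / 2π) ∫_{-Iℝ} S_L⁻¹(s, ∇) ds_I s^{α-1} ∇ v`. -/
def fAlphaValue (α : ℝ) (I : ℍ[ℝ]) (v : nabla.domain) : L2H :=
  (1 / (2 * Real.pi)) • ∫ t : ℝ, fAlphaIntegrand α I v t

theorem fAlphaValue_add (α : ℝ) (I : ℍ[ℝ]) (v w : nabla.domain)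
    (hv : Integrable (fAlphaIntegrand α I v) volume)
    (hw : Integrable (fAlphaIntegrand α I w) volume) :
    fAlphaValue α I (v + w) = fAlphaValue α I v + fAlphaValue α I w := by
  unfold fAlphaValue
  rw [fAlphaIntegrand_add, ← smul_add, ← integral_add hv hw]
  rfl

theorem fAlphaValue_smul (α : ℝ) (I : ℍ[ℝ]) (c : ℍ[ℝ]ᵐᵒᵖ) (v : nabla.domain)
    (hv : Integrable (fAlphaIntegrand α I v) volume) :
    fAlphaValue α I (c • v) = c • fAlphaValue α I v := by
  unfold fAlphaValue
  have h : ∫ t : ℝ, c • fAlphaIntegrand α I v t = c • ∫ t : ℝ, fAlphaIntegrand α I v t :=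
    (rightMul c).integral_comp_comm hv
  rw [fAlphaIntegrand_smul, h, smul_comm]

/-- The operator
`f_α(∇) v = (1 / 2π) ∫_{-Iℝ} S_L⁻¹(s, ∇) ds_I s^{α-1} ∇ v`, defined for all `v ∈ 𝒟(∇)` for which
the integral converges. -/
def fAlpha (α : ℝ) (I : ℍ[ℝ]) : Op where
  domain := fAlphaDomain α I
  toFun :=
    { toFun := fun v => fAlphaValue α I ⟨v.1, v.2.fst⟩
      map_add' := fun v w =>
        fAlphaValue_add α I ⟨v.1, v.2.fst⟩ ⟨w.1, w.2.fst⟩ v.2.snd w.2.snd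
      map_smul' := fun c v => fAlphaValue_smul α I c ⟨v.1, v.2.fst⟩ v.2.snd }

end QNabla

end

/-!
On the Fourier side every operator in this file is the multiplication, from the left, by a function
of `ξ` with values in the complexified quaternions `ℂ ⊗ ℍ`: with `r = 2π|ξ|`, the operator `∇` is
multiplication by `D(ξ) = 2πi (ξ₁ e₁ + ξ₂ e₂ + ξ₃ e₃)`, which satisfies `D² = r²`, and `(-Δ)^β` is
multiplication by `r^{2β}` (`mem_nablaGraph_iff`, `mem_fracLaplacianGraph_iff`). Hence `∇² = -Δ`.
A multiplier maps `L²(ℝ³, ℍ)` to itself as soon as it has the Hermitian symmetry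
`a(-ξ) = conj a(ξ)` and the product is square-integrable (`exists_multiplier`).

For `t ≠ 0`, the operator `𝒬_{-It}(∇) = t² - Δ` is inverted by the multiplier `1 / (t² + r²)`, and
`S_L⁻¹(-It, ∇) = (t² - Δ)⁻¹ t I - ∇ (t² - Δ)⁻¹`. Multiplied with
`(-It)^{α-1} = |t|^{α-1} (cos(π(α-1)/2) - sgn(t) sin(π(α-1)/2) I)`, this splits the integrand into
terms that are even in `t`, which do not contain `I`, and odd terms, which do
(`fAlphaIntegrand_eq`). Every term is `O(|t|^{α-1})` at `0`, because it acts on `∇v`, and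
`O(|t|^{α-2})` at infinity. So the integral converges for all `v ∈ 𝒟(∇)`, and the odd terms drop
out (`integral_fAlphaIntegrand`). For the even terms, the integral in `L²` is computed for almost
every `ξ` separately (`ft_integral`) from
`∫ |t|^β / (t² + r²) dt = π r^{β-1} / cos(πβ/2)`, `-1 < β < 1`, once for `β = α` and once for
`β = α - 1`. The result is that `f_α(∇)` has the symbol `½ r^{α-1} D + ½ r^α` (`ft_fAlpha`).

This symbol gives the remaining claims. It equals `r^{α-2} (½ r + ½ D) D`, the symbol of
`(-Δ)^{α/2-1} [½ (-Δ)^{1/2} + ½ ∇] ∇`. Its vector part is `½ r^{α-1} D`, since `D` is purely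
imaginary. It is bounded by a multiple of `1 + r²`, so that `(1 - Δ)⁻¹ f_α(∇)` extends to a bounded
operator while `(1 - Δ)⁻¹` is injective, and therefore the closure of the graph of `f_α(∇)` is a
graph (`exists_closed_extension`).
-/

noncomputable section

namespace QNabla

/-! ### Complexified quaternions -/

/-- The complexified quaternions `ℂ ⊗ ℍ`. -/
abbrev HC := QuaternionAlgebra ℂ (-1) 0 (-1)

/-- The complex coordinates of a complexified quaternion with respect to `1, e₁, e₂, e₃`. -/
def ccoord (k : Fin 4) : HC →ₗ[ℂ] ℂ where
  toFun a := ![a.re, a.imI, a.imJ, a.imK] k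
  map_add' a b := by fin_cases k <;> simp
  map_smul' c a := by fin_cases k <;> simp

@[simp] theorem ccoord_zero (a : HC) : ccoord 0 a = a.re := rfl
@[simp] theorem ccoord_one (a : HC) : ccoord 1 a = a.imI := rfl
@[simp] theorem ccoord_two (a : HC) : ccoord 2 a = a.imJ := rfl
@[simp] theorem ccoord_three (a : HC) : ccoord 3 a = a.imK := rfl

theorem ext_ccoord {a b : HC} (h : ∀ k, ccoord k a = ccoord k b) : a = b :=
  QuaternionAlgebra.ext (h 0) (h 1) (h 2) (h 3)

/-- The complexified quaternion with given complex coordinates. -/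
def ofCoord (u : Fin 4 → ℂ) : HC := ⟨u 0, u 1, u 2, u 3⟩

@[simp] theorem ccoord_ofCoord (u : Fin 4 → ℂ) (k : Fin 4) : ccoord k (ofCoord u) = u k := by
  fin_cases k <;> rfl

/-- The inclusion of `ℍ` into its complexification. -/
def cplx : ℍ[ℝ] →+* HC where
  toFun q := ⟨q.re, q.imI, q.imJ, q.imK⟩
  map_one' := by ext <;> simp
  map_zero' := by ext <;> simp
  map_add' a b := by ext <;> simp
  map_mul' a b := by ext <;> simp <;> ring

@[simp] theorem cplx_re (q : ℍ[ℝ]) : (cplx q).re = q.re := rfl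
@[simp] theorem cplx_imI (q : ℍ[ℝ]) : (cplx q).imI = q.imI := rfl
@[simp] theorem cplx_imJ (q : ℍ[ℝ]) : (cplx q).imJ = q.imJ := rfl
@[simp] theorem cplx_imK (q : ℍ[ℝ]) : (cplx q).imK = q.imK := rfl

theorem cplx_smul (r : ℝ) (q : ℍ[ℝ]) : cplx (r • q) = (r : ℂ) • cplx q := by
  ext <;> simp

theorem cplx_injective : Function.Injective cplx := by
  intro a b h
  ext
  · simpa using congrArg QuaternionAlgebra.re h
  · simpa using congrArg QuaternionAlgebra.imI h
  · simpa using congrArg QuaternionAlgebra.imJ h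
  · simpa using congrArg QuaternionAlgebra.imK h

theorem ccoord_cplx (k : Fin 4) (q : ℍ[ℝ]) : ccoord k (cplx q) = ((coord k q : ℝ) : ℂ) := by
  fin_cases k <;> rfl

theorem ccoord_basis (x : HC) : x = ∑ j, ccoord j x • cplx (basisH j) := by
  have h (a b c d : ℝ) : cplx ⟨a, b, c, d⟩ = ⟨a, b, c, d⟩ := rfl
  ext <;> simp [Fin.sum_univ_four, basisH, e, h]

/-- The `ℓ¹`-norm on the complexified quaternions, which is submultiplicative. -/
def sn (a : HC) : ℝ := ‖a.re‖ + ‖a.imI‖ + ‖a.imJ‖ + ‖a.imK‖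

theorem sn_nonneg (a : HC) : 0 ≤ sn a := by unfold sn; positivity

theorem norm_ccoord_le (k : Fin 4) (a : HC) : ‖ccoord k a‖ ≤ sn a := by
  have h1 := norm_nonneg a.re
  have h2 := norm_nonneg a.imI
  have h3 := norm_nonneg a.imJ
  have h4 := norm_nonneg a.imK
  unfold sn
  fin_cases k <;> simp <;> linarith

theorem sn_eq_sum (a : HC) : sn a = ∑ k, ‖ccoord k a‖ := by
  simp [sn, Fin.sum_univ_four]

theorem sn_smul (c : ℂ) (a : HC) : sn (c • a) = ‖c‖ * sn a := by
  simp [sn]; ring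

theorem sn_add_le (a b : HC) : sn (a + b) ≤ sn a + sn b := by
  simp only [sn_eq_sum, map_add, ← Finset.sum_add_distrib]
  exact Finset.sum_le_sum fun k _ => norm_add_le _ _

theorem sn_mul_le (a b : HC) : sn (a * b) ≤ sn a * sn b := by
  have h (p q r s : ℂ) : ‖p - q - r - s‖ ≤ ‖p‖ + ‖q‖ + ‖r‖ + ‖s‖ := by
    linarith [norm_sub_le (p - q - r) s, norm_sub_le (p - q) r, norm_sub_le p q]
  have h' (p q r s : ℂ) : ‖p + q + r - s‖ ≤ ‖p‖ + ‖q‖ + ‖r‖ + ‖s‖ := by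
    linarith [norm_sub_le (p + q + r) s, norm_add_le (p + q) r, norm_add_le p q]
  have h'' (p q r s : ℂ) : ‖p - q + r + s‖ ≤ ‖p‖ + ‖q‖ + ‖r‖ + ‖s‖ := by
    linarith [norm_add_le (p - q + r) s, norm_add_le (p - q) r, norm_sub_le p q]
  have h3 (p q r s : ℂ) : ‖p + q - r + s‖ ≤ ‖p‖ + ‖q‖ + ‖r‖ + ‖s‖ := by
    linarith [norm_add_le (p + q - r) s, norm_sub_le (p + q) r, norm_add_le p q]
  unfold sn
  have k1 := h (a.re * b.re) (a.imI * b.imI) (a.imJ * b.imJ) (a.imK * b.imK)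
  have k2 := h' (a.re * b.imI) (a.imI * b.re) (a.imJ * b.imK) (a.imK * b.imJ)
  have k3 := h'' (a.re * b.imJ) (a.imI * b.imK) (a.imJ * b.re) (a.imK * b.imI)
  have k4 := h3 (a.re * b.imK) (a.imI * b.imJ) (a.imJ * b.imI) (a.imK * b.re)
  simp only [norm_mul] at k1 k2 k3 k4
  have e1 : (a * b).re = a.re * b.re - a.imI * b.imI - a.imJ * b.imJ - a.imK * b.imK := by
    simp; ring
  have e2 : (a * b).imI = a.re * b.imI + a.imI * b.re + a.imJ * b.imK - a.imK * b.imJ := by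
    simp; ring
  have e3 : (a * b).imJ = a.re * b.imJ - a.imI * b.imK + a.imJ * b.re + a.imK * b.imI := by
    simp; ring
  have e4 : (a * b).imK = a.re * b.imK + a.imI * b.imJ - a.imJ * b.imI + a.imK * b.re := by
    simp
  rw [e1, e2, e3, e4]
  linarith

/-- Complex conjugation of the coordinates of a complexified quaternion. -/
def cconj (a : HC) : HC :=
  ⟨starRingEnd ℂ a.re, starRingEnd ℂ a.imI, starRingEnd ℂ a.imJ, starRingEnd ℂ a.imK⟩

theorem ccoord_cconj (k : Fin 4) (a : HC) :
    ccoord k (cconj a) = starRingEnd ℂ (ccoord k a) := by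
  fin_cases k <;> rfl

theorem cconj_mul (a b : HC) : cconj (a * b) = cconj a * cconj b := by
  ext <;> simp [cconj]

theorem cconj_add (a b : HC) : cconj (a + b) = cconj a + cconj b := by
  ext <;> simp [cconj]

theorem cconj_ofReal_smul (r : ℝ) (a : HC) : cconj ((r : ℂ) • a) = (r : ℂ) • cconj a := by
  ext <;> simp [cconj]

theorem cconj_one : cconj 1 = 1 := by
  ext <;> simp [cconj]

/-! ### The Fourier transform on `L²(ℝ³, ℍ)` -/

/-- The Fourier transform of `v ∈ L²(ℝ³, ℍ)`, taken componentwise, as a function with values in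
the complexified quaternions. It is determined by `v` almost everywhere. -/
def ft (v : L2H) (ξ : E3) : HC :=
  ofCoord fun k => (𝓕 (cplxComp k v) : Lp ℂ 2 (volume : Measure E3)) ξ

theorem ccoord_ft (k : Fin 4) (v : L2H) (ξ : E3) :
    ccoord k (ft v ξ) = (𝓕 (cplxComp k v) : Lp ℂ 2 (volume : Measure E3)) ξ :=
  ccoord_ofCoord _ k

theorem coeFn_cplxComp (k : Fin 4) (v : L2H) :
    cplxComp k v =ᵐ[volume] fun x => ((coord k (v x) : ℝ) : ℂ) :=
  (Complex.ofRealCLM ∘L coord k).coeFn_compLp v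

theorem memLp_ccoord_ft (k : Fin 4) (v : L2H) :
    MemLp (fun ξ => ccoord k (ft v ξ)) 2 (volume : Measure E3) := by
  simp only [ccoord_ft]
  exact Lp.memLp _

theorem coeFn_sum_smul {ι : Type*} (s : Finset ι) (c : ι → ℂ)
    (f : ι → Lp ℂ 2 (volume : Measure E3)) :
    (∑ j ∈ s, c j • f j : Lp ℂ 2 (volume : Measure E3)) =ᵐ[volume]
      fun x => ∑ j ∈ s, c j * f j x := by
  classical
  induction s using Finset.induction_on with
  | empty =>
    simp only [Finset.sum_empty]
    exact Lp.coeFn_zero ℂ 2 (volume : Measure E3)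
  | insert a s ha ih =>
    rw [Finset.sum_insert ha]
    filter_upwards [ih, Lp.coeFn_add (c a • f a) (∑ j ∈ s, c j • f j),
      Lp.coeFn_smul (c a) (f a)] with x h1 h2 h3
    rw [h2, Pi.add_apply, h1, h3, Finset.sum_insert ha]
    rfl

theorem cplxComp_compLp (L : ℍ[ℝ] →L[ℝ] ℍ[ℝ]) (k : Fin 4) (v : L2H) :
    cplxComp k (L.compLp v) =
      ∑ j, ((coord k (L (basisH j)) : ℝ) : ℂ) • cplxComp j v := by
  refine Lp.ext ?_
  have hall : ∀ᵐ x ∂(volume : Measure E3), ∀ j, cplxComp j v x = ((coord j (v x) : ℝ) : ℂ) :=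
    ae_all_iff.2 fun j => coeFn_cplxComp j v
  filter_upwards [coeFn_cplxComp k (L.compLp v), L.coeFn_compLp v, hall,
    coeFn_sum_smul Finset.univ (fun j => ((coord k (L (basisH j)) : ℝ) : ℂ))
      fun j => cplxComp j v] with x h1 h2 h3 h4
  rw [h1, h2, h4]
  conv_lhs => rw [coord_basisH (v x)]
  simp only [map_sum, map_smul, smul_eq_mul, h3]
  push_cast
  exact Finset.sum_congr rfl fun j _ => mul_comm _ _

/-- A real-linear map `L : ℍ → ℍ` applied pointwise acts on the Fourier transform as its
complexification. -/
theorem ft_compLp (L : ℍ[ℝ] →L[ℝ] ℍ[ℝ]) (v : L2H) :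
    ft (L.compLp v) =ᵐ[volume] fun ξ => ∑ j, ccoord j (ft v ξ) • cplx (L (basisH j)) := by
  have h (k : Fin 4) : (𝓕 (cplxComp k (L.compLp v)) : Lp ℂ 2 (volume : Measure E3)) =ᵐ[volume]
      fun ξ => ∑ j, ((coord k (L (basisH j)) : ℝ) : ℂ) *
        (𝓕 (cplxComp j v) : Lp ℂ 2 (volume : Measure E3)) ξ := by
    rw [cplxComp_compLp]
    have := map_sum (Lp.fourierTransformₗᵢ E3 ℂ)
      (fun j => ((coord k (L (basisH j)) : ℝ) : ℂ) • cplxComp j v) Finset.univ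
    simp only [map_smul] at this
    change (Lp.fourierTransformₗᵢ E3 ℂ) _ =ᵐ[volume] _
    rw [this]
    exact coeFn_sum_smul _ _ _
  filter_upwards [ae_all_iff.2 h] with ξ hξ
  refine ext_ccoord fun k => ?_
  rw [ccoord_ft, hξ, map_sum]
  refine Finset.sum_congr rfl fun j _ => ?_
  rw [map_smul, ccoord_cplx, ccoord_ft, smul_eq_mul, mul_comm]

theorem ft_add (v w : L2H) : ft (v + w) =ᵐ[volume] fun ξ => ft v ξ + ft w ξ := by
  have h (k : Fin 4) : (𝓕 (cplxComp k (v + w)) : Lp ℂ 2 (volume : Measure E3)) =ᵐ[volume]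
      fun ξ => (𝓕 (cplxComp k v) : Lp ℂ 2 (volume : Measure E3)) ξ +
        (𝓕 (cplxComp k w) : Lp ℂ 2 (volume : Measure E3)) ξ := by
    rw [cplxComp_add, FourierTransform.fourier_add]
    exact Lp.coeFn_add _ _
  filter_upwards [ae_all_iff.2 h] with ξ hξ
  refine ext_ccoord fun k => ?_
  rw [map_add, ccoord_ft, hξ, ccoord_ft, ccoord_ft]

theorem sum_ccoord_mul_left (q : ℍ[ℝ]) (x : HC) :
    ∑ j, ccoord j x • cplx (q * basisH j) = cplx q * x := by
  conv_rhs => rw [ccoord_basis x, Finset.mul_sum]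
  refine Finset.sum_congr rfl fun j _ => ?_
  rw [map_mul, mul_smul_comm]

theorem sum_ccoord_mul_right (q : ℍ[ℝ]) (x : HC) :
    ∑ j, ccoord j x • cplx (basisH j * q) = x * cplx q := by
  conv_rhs => rw [ccoord_basis x, Finset.sum_mul]
  refine Finset.sum_congr rfl fun j _ => ?_
  rw [map_mul, smul_mul_assoc]

theorem ft_smul (q : ℍ[ℝ]) (v : L2H) : ft (q • v) =ᵐ[volume] fun ξ => cplx q * ft v ξ := by
  have h : q • v = (ContinuousLinearMap.mul ℝ ℍ[ℝ] q).compLp v := by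
    refine Lp.ext ?_
    filter_upwards [Lp.coeFn_smul q v, (ContinuousLinearMap.mul ℝ ℍ[ℝ] q).coeFn_compLp v]
      with x h1 h2
    rw [h1, h2]
    rfl
  rw [h]
  filter_upwards [ft_compLp (ContinuousLinearMap.mul ℝ ℍ[ℝ] q) v] with ξ hξ
  rw [hξ]
  exact sum_ccoord_mul_left q _

theorem ft_op_smul (q : ℍ[ℝ]ᵐᵒᵖ) (v : L2H) :
    ft (q • v) =ᵐ[volume] fun ξ => ft v ξ * cplx q.unop := by
  have h : q • v = ((ContinuousLinearMap.mul ℝ ℍ[ℝ]).flip q.unop).compLp v := by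
    refine Lp.ext ?_
    filter_upwards [Lp.coeFn_smul q v,
      ((ContinuousLinearMap.mul ℝ ℍ[ℝ]).flip q.unop).coeFn_compLp v] with x h1 h2
    rw [h1, h2]
    rfl
  rw [h]
  filter_upwards [ft_compLp ((ContinuousLinearMap.mul ℝ ℍ[ℝ]).flip q.unop) v] with ξ hξ
  rw [hξ]
  exact sum_ccoord_mul_right q.unop _

theorem ft_real_smul (r : ℝ) (v : L2H) : ft (r • v) =ᵐ[volume] fun ξ => (r : ℂ) • ft v ξ := by
  have h : r • v = (r • ContinuousLinearMap.id ℝ ℍ[ℝ]).compLp v := by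
    refine Lp.ext ?_
    filter_upwards [Lp.coeFn_smul r v, (r • ContinuousLinearMap.id ℝ ℍ[ℝ]).coeFn_compLp v]
      with x h1 h2
    rw [h1, h2]
    rfl
  rw [h]
  filter_upwards [ft_compLp (r • ContinuousLinearMap.id ℝ ℍ[ℝ]) v] with ξ hξ
  rw [hξ]
  conv_rhs => rw [ccoord_basis (ft v ξ), Finset.smul_sum]
  refine Finset.sum_congr rfl fun j _ => ?_
  rw [_root_.smul_apply, ContinuousLinearMap.id_apply, cplx_smul, smul_comm]

theorem ft_neg (v : L2H) : ft (-v) =ᵐ[volume] fun ξ => -ft v ξ := by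
  rw [← neg_one_smul ℝ v]
  filter_upwards [ft_real_smul (-1) v] with ξ h
  rw [h]
  simp

theorem ft_sub (v w : L2H) : ft (v - w) =ᵐ[volume] fun ξ => ft v ξ - ft w ξ := by
  rw [sub_eq_add_neg]
  filter_upwards [ft_add v (-w), ft_neg w] with ξ h1 h2
  rw [h1, h2, sub_eq_add_neg]

theorem ft_zero : ft 0 =ᵐ[volume] fun _ => 0 := by
  have := ft_real_smul 0 0
  simpa using this

/-- The Fourier transform of the pointwise real component `v_k` is the `k`-th component. -/
theorem ft_realComp (k : Fin 4) (v : L2H) :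
    ft (realComp k v) =ᵐ[volume] fun ξ => ccoord k (ft v ξ) • (1 : HC) := by
  filter_upwards [ft_compLp (realIncl ∘L coord k) v] with ξ hξ
  refine Eq.trans hξ ?_
  have h (j : Fin 4) : cplx ((realIncl ∘L coord k) (basisH j)) =
      (if j = k then (1 : ℂ) else 0) • 1 := by
    have h1 : (realIncl ∘L coord k) (basisH j) = coord k (basisH j) • (1 : ℍ[ℝ]) := rfl
    have h2 : coord k (basisH j) = if j = k then 1 else 0 := by
      fin_cases k <;> fin_cases j <;> rfl
    rw [h1, cplx_smul, map_one, h2]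
    split_ifs <;> simp
  simp only [h, smul_smul, mul_ite, mul_one, mul_zero]
  simp

theorem ft_imPart (v : L2H) :
    ft (imPart v) =ᵐ[volume] fun ξ => ft v ξ - (ft v ξ).re • (1 : HC) := by
  have h : imPart v = v - realComp 0 v := by
    refine Lp.ext ?_
    filter_upwards [(ContinuousLinearMap.id ℝ ℍ[ℝ] - realIncl ∘L coord 0).coeFn_compLp v,
      Lp.coeFn_sub v (realComp 0 v), (realIncl ∘L coord 0).coeFn_compLp v] with x h1 h2 h3
    refine Eq.trans h1 ?_
    rw [h2, Pi.sub_apply]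
    exact congrArg (v x - ·) h3.symm
  rw [h]
  filter_upwards [ft_sub v (realComp 0 v), ft_realComp 0 v] with ξ h1 h2
  rw [h1, h2, ccoord_zero]

theorem eq_of_ft_eq {v w : L2H} (h : ft v =ᵐ[volume] ft w) : v = w := by
  rw [← sub_eq_zero]
  refine eq_zero_of_cplxComp fun k => ?_
  rw [← (Lp.fourierTransformₗᵢ E3 ℂ).map_eq_zero_iff, Lp.eq_zero_iff_ae_eq_zero]
  filter_upwards [ft_sub v w, h] with ξ h1 h2
  have := ccoord_ft k (v - w) ξ
  rw [h1, h2, sub_self, map_zero] at this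
  exact this.symm

/-! ### `∇` and `-Δ` as Fourier multipliers -/

/-- The Parseval formula with one Schwartz factor. -/
theorem integral_schwartz_mul_fourier (ψ : 𝓢(E3, ℂ)) (f : Lp ℂ 2 (volume : Measure E3)) :
    ∫ x, ψ x * (𝓕 f : Lp ℂ 2 (volume : Measure E3)) x = ∫ x, (𝓕 ψ) x * f x := by
  have h := congrArg (fun T => T ψ) (Lp.fourier_toTemperedDistribution_eq f)
  simp only [TemperedDistribution.fourier_apply, Lp.toTemperedDistribution_apply,
    smul_eq_mul] at h
  exact h.symm

theorem integrable_schwartz_mul (ψ : 𝓢(E3, ℂ)) {f : E3 → ℂ} (hf : MemLp f 2 volume) :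
    Integrable (fun x => ψ x * f x) (volume : Measure E3) :=
  memLp_one_iff_integrable.1 (hf.smul (ψ.memLp 2 volume) (r := 1))

theorem ae_eq_zero_of_integral_schwartz_mul {f : E3 → ℂ} (hf : LocallyIntegrable f volume)
    (h : ∀ ψ : 𝓢(E3, ℂ), ∫ x, ψ x * f x = 0) : f =ᵐ[volume] 0 := by
  refine ae_eq_zero_of_integral_contDiff_smul_eq_zero hf ?_
  intro g hg hs
  have hg' : ContDiff ℝ (⊤ : ℕ∞) fun x => (g x : ℂ) := Complex.ofRealCLM.contDiff.comp hg
  have hs' : HasCompactSupport fun x => (g x : ℂ) := hs.comp_left Complex.ofReal_zero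
  exact h (hs'.toSchwartzMap hg')

/-- The coordinatewise pairing of a complex test function with a function with values in the
complexified quaternions. -/
def cpair (u : E3 → HC) (hu : ∀ k, MemLp (fun x => ccoord k (u x)) 2 volume) :
    𝓢(E3, ℂ) →ₗ[ℂ] HC where
  toFun ψ := ofCoord fun k => ∫ x, ψ x * ccoord k (u x)
  map_add' ψ χ := by
    refine ext_ccoord fun k => ?_
    simp only [map_add, ccoord_ofCoord, _root_.add_apply, add_mul]
    exact integral_add (integrable_schwartz_mul ψ (hu k)) (integrable_schwartz_mul χ (hu k))
  map_smul' c ψ := by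
    refine ext_ccoord fun k => ?_
    simp only [map_smul, ccoord_ofCoord, _root_.smul_apply, smul_eq_mul, mul_assoc,
      RingHom.id_apply]
    exact integral_const_mul _ _

theorem ccoord_cpair (u : E3 → HC) (hu) (ψ : 𝓢(E3, ℂ)) (k : Fin 4) :
    ccoord k (cpair u hu ψ) = ∫ x, ψ x * ccoord k (u x) := ccoord_ofCoord _ _

theorem memLp_ccoord_cplx (v : L2H) (k : Fin 4) :
    MemLp (fun x => ccoord k (cplx (v x))) 2 (volume : Measure E3) := by
  simp only [ccoord_cplx]
  exact (memLp_congr_ae (coeFn_cplxComp k v)).1 (Lp.memLp _)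

theorem cplx_pairing (φ : 𝓢(E3, ℝ)) (v : L2H) :
    cplx (pairing φ v) =
      cpair (fun x => cplx (v x)) (memLp_ccoord_cplx v) (φ.postcompCLM Complex.ofRealCLM) := by
  refine ext_ccoord fun k => ?_
  rw [ccoord_cplx, ccoord_cpair, pairing, ← (coord k).integral_comp_comm (integrable_pairing φ v)]
  simp only [map_smul, ccoord_cplx, smul_eq_mul]
  rw [← integral_complex_ofReal]
  simp

theorem cpair_fourier (v : L2H) (ψ : 𝓢(E3, ℂ)) :
    cpair (fun x => cplx (v x)) (memLp_ccoord_cplx v) (𝓕 ψ) =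
      cpair (ft v) (fun k => memLp_ccoord_ft k v) ψ := by
  refine ext_ccoord fun k => ?_
  rw [ccoord_cpair, ccoord_cpair]
  simp only [ccoord_ft, integral_schwartz_mul_fourier]
  refine integral_congr_ae ?_
  filter_upwards [coeFn_cplxComp k v] with x hx
  rw [hx, ccoord_cplx]

theorem schwartz_eq_re_add_im (ψ : 𝓢(E3, ℂ)) :
    ψ = (ψ.postcompCLM Complex.reCLM).postcompCLM Complex.ofRealCLM +
      Complex.I • (ψ.postcompCLM Complex.imCLM).postcompCLM Complex.ofRealCLM := by
  ext x
  simp only [_root_.add_apply, _root_.smul_apply, SchwartzMap.postcompCLM_apply,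
    Complex.ofRealCLM_apply, Complex.reCLM_apply, Complex.imCLM_apply, smul_eq_mul]
  rw [mul_comm]
  exact (Complex.re_add_im _).symm

/-- A complex-linear map on complex Schwartz functions that vanishes on the real ones is zero. -/
theorem linearMap_schwartz_eq_zero {A : 𝓢(E3, ℂ) →ₗ[ℂ] HC}
    (h : ∀ φ : 𝓢(E3, ℝ), A (φ.postcompCLM Complex.ofRealCLM) = 0) (ψ : 𝓢(E3, ℂ)) : A ψ = 0 := by
  rw [schwartz_eq_re_add_im ψ, map_add, map_smul, h, h, smul_zero, add_zero]

theorem lineDerivOp_ofReal (m : E3) (φ : 𝓢(E3, ℝ)) :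
    ∂_{m} (φ.postcompCLM Complex.ofRealCLM : 𝓢(E3, ℂ)) =
      (∂_{m} φ).postcompCLM Complex.ofRealCLM := by
  ext x
  rw [SchwartzMap.lineDerivOp_apply_eq_fderiv, SchwartzMap.postcompCLM_apply,
    SchwartzMap.lineDerivOp_apply_eq_fderiv]
  have h : HasFDerivAt (fun y => Complex.ofRealCLM (φ y)) (Complex.ofRealCLM ∘L fderiv ℝ φ x) x :=
    Complex.ofRealCLM.hasFDerivAt.comp x φ.differentiableAt.hasFDerivAt
  have h2 : fderiv ℝ (φ.postcompCLM Complex.ofRealCLM : 𝓢(E3, ℂ)) x = _ := h.fderiv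
  rw [h2]
  rfl

theorem laplacian_eq_sum_ee {F : Type*} [NormedAddCommGroup F] [NormedSpace ℝ F] (ψ : 𝓢(E3, F)) :
    Δ ψ = ∑ i, ∂_{ee i} (∂_{ee i} ψ) := by
  rw [SchwartzMap.laplacian_eq_sum (EuclideanSpace.basisFun (Fin 3) ℝ)]
  simp [ee]

theorem laplacian_ofReal (φ : 𝓢(E3, ℝ)) :
    Δ (φ.postcompCLM Complex.ofRealCLM : 𝓢(E3, ℂ)) = (Δ φ).postcompCLM Complex.ofRealCLM := by
  rw [laplacian_eq_sum_ee, laplacian_eq_sum_ee, map_sum]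
  simp only [lineDerivOp_ofReal]

/-- `∂ᵢ ψ̂` is the Fourier transform of `-2πi xᵢ ψ`. -/
theorem lineDerivOp_fourier_ee (i : Fin 3) (ψ : 𝓢(E3, ℂ)) :
    ∃ χ : 𝓢(E3, ℂ), ∂_{ee i} (𝓕 ψ) = 𝓕 χ ∧
      ∀ x, χ x = -(2 * Real.pi * Complex.I * (x i : ℝ)) * ψ x := by
  refine ⟨_, SchwartzMap.lineDerivOp_fourier_eq ψ (ee i), fun x => ?_⟩
  have ht : (fun y : E3 => inner ℝ y (ee i)).HasTemperateGrowth := by fun_prop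
  rw [_root_.smul_apply, SchwartzMap.smulLeftCLM_apply_apply ht]
  simp [ee, EuclideanSpace.inner_single_right]
  ring

/-- The symbol `2π(iξ₁ e₁ + iξ₂ e₂ + iξ₃ e₃)` of `∇`. -/
def symD (ξ : E3) : HC := ∑ i, (2 * Real.pi * Complex.I * (ξ i : ℝ)) • cplx (e i)

/-- The square root `2π|ξ|` of the symbol of `-Δ`. -/
def rad (ξ : E3) : ℝ := 2 * Real.pi * ‖ξ‖

theorem symD_mul_symD (ξ : E3) : symD ξ * symD ξ = ((rad ξ ^ 2 : ℝ) : ℂ) • (1 : HC) := by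
  have h (a b c d : ℝ) : cplx ⟨a, b, c, d⟩ = ⟨a, b, c, d⟩ := rfl
  have hn : (‖ξ‖ : ℂ) ^ 2 = (ξ 0 : ℂ) ^ 2 + (ξ 1 : ℂ) ^ 2 + (ξ 2 : ℂ) ^ 2 := by
    have := EuclideanSpace.real_norm_sq_eq ξ
    rw [Fin.sum_univ_three] at this
    exact_mod_cast this
  have hI := Complex.I_sq
  unfold symD rad
  ext
  · simp [Fin.sum_univ_three, e, h]
    rw [mul_pow, hn]
    linear_combination
      (-4 * (Real.pi : ℂ) ^ 2 * ((ξ 0 : ℂ) ^ 2 + (ξ 1 : ℂ) ^ 2 + (ξ 2 : ℂ) ^ 2)) * hI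
  · simp [Fin.sum_univ_three, e, h]; ring
  · simp [Fin.sum_univ_three, e, h]; ring
  · simp [Fin.sum_univ_three, e, h]; ring

theorem continuous_ccoord_symD (k : Fin 4) : Continuous fun ξ => ccoord k (symD ξ) := by
  simp only [symD, map_sum, map_smul]
  fun_prop

theorem ccoord_mul (k : Fin 4) (a x : HC) :
    ccoord k (a * x) = ∑ j, ccoord k (a * cplx (basisH j)) * ccoord j x := by
  conv_lhs => rw [ccoord_basis x, Finset.mul_sum, map_sum]
  refine Finset.sum_congr rfl fun j _ => ?_
  rw [mul_smul_comm, map_smul, smul_eq_mul, mul_comm]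

theorem locallyIntegrable_mul_of_memLp {m f : E3 → ℂ} (hm : Continuous m)
    (hf : MemLp f 2 (volume : Measure E3)) : LocallyIntegrable (fun x => m x * f x) volume := by
  have := hf.locallyIntegrable (by norm_num)
  rw [locallyIntegrable_iff] at this ⊢
  exact fun K hK => (this K hK).continuousOn_mul hm.continuousOn hK

theorem continuous_ccoord_mul {a : E3 → HC} (ha : ∀ k, Continuous fun ξ => ccoord k (a ξ))
    (k : Fin 4) (q : HC) : Continuous fun ξ => ccoord k (a ξ * q) := by
  have h (ξ : E3) : ccoord k (a ξ * q) =
      ∑ j, ccoord j (a ξ) * ccoord k (cplx (basisH j) * q) := by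
    conv_lhs => rw [ccoord_basis (a ξ), Finset.sum_mul, map_sum]
    refine Finset.sum_congr rfl fun j _ => ?_
    rw [smul_mul_assoc, map_smul, smul_eq_mul]
  simp only [h]
  exact continuous_finsetSum _ fun j _ => (ha j).mul continuous_const

/-- The equation `ŵ = a v̂` can be tested against Schwartz functions. -/
theorem ft_eq_iff_forall_integral {a : E3 → HC} (ha : ∀ k, Continuous fun ξ => ccoord k (a ξ))
    (v w : L2H) :
    (ft w =ᵐ[volume] fun ξ => a ξ * ft v ξ) ↔ ∀ (ψ : 𝓢(E3, ℂ)) (k : Fin 4),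
      ∫ ξ, ψ ξ * (ccoord k (ft w ξ) - ccoord k (a ξ * ft v ξ)) = 0 := by
  constructor
  · intro h ψ k
    rw [integral_eq_zero_of_ae]
    filter_upwards [h] with ξ hξ
    simp [hξ]
  · intro h
    have hk (k : Fin 4) : ∀ᵐ ξ ∂(volume : Measure E3),
        ccoord k (ft w ξ) - ccoord k (a ξ * ft v ξ) = 0 := by
      refine ae_eq_zero_of_integral_schwartz_mul ?_ fun ψ => h ψ k
      refine ((memLp_ccoord_ft k w).locallyIntegrable (by norm_num)).sub ?_
      simp only [ccoord_mul k _ (ft v _)]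
      refine locallyIntegrable_finsetSum _ fun j _ => ?_
      exact locallyIntegrable_mul_of_memLp (continuous_ccoord_mul ha k _) (memLp_ccoord_ft j v)
    filter_upwards [ae_all_iff.2 hk] with ξ hξ
    exact ext_ccoord fun k => sub_eq_zero.1 (hξ k)

/-- The distributional equation `w = ∇v`, which is tested against real Schwartz functions, extends
to complex ones `𝓕 ψ` by linearity. There it becomes `ŵ = D v̂` tested against `ψ`. -/
theorem mem_nablaGraph_iff (v w : L2H) :
    (v, w) ∈ nablaGraph ↔ ft w =ᵐ[volume] fun ξ => symD ξ * ft v ξ := by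
  let A : 𝓢(E3, ℂ) →ₗ[ℂ] HC :=
    ∑ i, LinearMap.mulLeft ℂ (cplx (e i)) ∘ₗ
      cpair (fun x => cplx (v x)) (memLp_ccoord_cplx v) ∘ₗ
        (LineDeriv.lineDerivOpCLM ℂ 𝓢(E3, ℂ) (ee i)).toLinearMap +
    cpair (fun x => cplx (w x)) (memLp_ccoord_cplx w)
  have hA (ψ : 𝓢(E3, ℂ)) : A ψ =
      ∑ i, cplx (e i) * cpair (fun x => cplx (v x)) (memLp_ccoord_cplx v) (∂_{ee i} ψ) +
        cpair (fun x => cplx (w x)) (memLp_ccoord_cplx w) ψ := by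
    simp [A, LinearMap.sum_apply]
  have h1 : (v, w) ∈ nablaGraph ↔
      ∀ φ : 𝓢(E3, ℝ), A (φ.postcompCLM Complex.ofRealCLM) = 0 := by
    refine forall_congr' fun φ => ?_
    rw [hA, ← cplx_injective.eq_iff, ← sub_eq_zero, map_neg, sub_neg_eq_add, map_sum]
    simp only [map_mul, cplx_pairing, lineDerivOp_ofReal]
  have h2 : (∀ φ : 𝓢(E3, ℝ), A (φ.postcompCLM Complex.ofRealCLM) = 0) ↔
      ∀ ψ : 𝓢(E3, ℂ), A (𝓕 ψ) = 0 := by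
    refine ⟨fun h ψ => linearMap_schwartz_eq_zero h _, fun h φ => ?_⟩
    have := h (𝓕⁻ (φ.postcompCLM Complex.ofRealCLM : 𝓢(E3, ℂ)))
    rwa [FourierTransform.fourier_fourierInv_eq] at this
  rw [h1, h2, ft_eq_iff_forall_integral continuous_ccoord_symD]
  refine forall_congr' fun ψ => ?_
  choose χ hχ hχ' using fun i => lineDerivOp_fourier_ee i ψ
  have h3 (k : Fin 4) : ccoord k (A (𝓕 ψ)) =
      ∫ ξ, ψ ξ * (ccoord k (ft w ξ) - ccoord k (symD ξ * ft v ξ)) := by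
    have hint (i : Fin 3) (j : Fin 4) :
        Integrable (fun ξ => χ i ξ * ccoord j (ft v ξ)) (volume : Measure E3) :=
      integrable_schwartz_mul (χ i) (memLp_ccoord_ft j v)
    rw [hA]
    simp only [hχ, cpair_fourier, map_add, map_sum]
    have e3 (i : Fin 3) : ccoord k (cplx (e i) * cpair (ft v) (fun k => memLp_ccoord_ft k v) (χ i)) =
        ∑ j, ccoord k (cplx (e i) * cplx (basisH j)) * ∫ ξ, χ i ξ * ccoord j (ft v ξ) := by
      rw [ccoord_mul]
      simp only [ccoord_cpair]
    simp only [e3, ccoord_cpair]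
    have e0 (i : Fin 3) (j : Fin 4) : ccoord k (cplx (e i) * cplx (basisH j)) *
        ∫ ξ, χ i ξ * ccoord j (ft v ξ) = ∫ ξ, ccoord k (cplx (e i) * cplx (basisH j)) *
        (χ i ξ * ccoord j (ft v ξ)) := (integral_const_mul _ _).symm
    simp only [e0]
    have e1 (i : Fin 3) : ∑ j, ∫ ξ, ccoord k (cplx (e i) * cplx (basisH j)) *
        (χ i ξ * ccoord j (ft v ξ)) = ∫ ξ, ∑ j, ccoord k (cplx (e i) * cplx (basisH j)) *
        (χ i ξ * ccoord j (ft v ξ)) :=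
      (integral_finsetSum _ fun j _ => (hint i j).const_mul _).symm
    simp only [e1]
    rw [← integral_finsetSum _ fun i _ =>
      integrable_finsetSum _ fun j _ => (hint i j).const_mul _,
      ← integral_add (integrable_finsetSum _ fun i _ =>
        integrable_finsetSum _ fun j _ => (hint i j).const_mul _)
        (integrable_schwartz_mul ψ (memLp_ccoord_ft k w))]
    refine integral_congr_ae (ae_of_all _ fun ξ => ?_)
    have e2 : symD ξ * ft v ξ = ∑ i, (2 * Real.pi * Complex.I * (ξ i : ℝ)) •
        (cplx (e i) * ft v ξ) := by
      rw [symD, Finset.sum_mul]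
      simp only [smul_mul_assoc]
    simp only [e2, map_sum, map_smul, hχ', ccoord_mul k (cplx (e _)) (ft v ξ), smul_eq_mul]
    rw [mul_sub, sub_eq_neg_add, Finset.mul_sum, ← Finset.sum_neg_distrib]
    congr 1
    refine Finset.sum_congr rfl fun i _ => ?_
    rw [Finset.mul_sum, Finset.mul_sum, ← Finset.sum_neg_distrib]
    exact Finset.sum_congr rfl fun j _ => by ring
  refine ⟨fun h k => by rw [← h3, h, map_zero], fun h => ext_ccoord fun k => ?_⟩
  rw [h3, h, map_zero]

/-- `Δ ψ̂` is the Fourier transform of `-|2πx|² ψ`. -/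
theorem laplacian_fourier (ψ : 𝓢(E3, ℂ)) :
    ∃ χ : 𝓢(E3, ℂ), Δ (𝓕 ψ) = 𝓕 χ ∧ ∀ x, χ x = -((rad x ^ 2 : ℝ) : ℂ) * ψ x := by
  choose χ hχ hχ' using fun i => lineDerivOp_fourier_ee i ψ
  choose η hη hη' using fun i => lineDerivOp_fourier_ee i (χ i)
  refine ⟨∑ i, η i, ?_, fun x => ?_⟩
  · rw [laplacian_eq_sum_ee]
    simp only [hχ, hη]
    exact (map_sum (FourierTransform.fourierCLM ℂ 𝓢(E3, ℂ)) _ _).symm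
  · rw [_root_.sum_apply]
    simp only [hη', hχ', Fin.sum_univ_three]
    have hn : (‖x‖ : ℂ) ^ 2 = (x 0 : ℂ) ^ 2 + (x 1 : ℂ) ^ 2 + (x 2 : ℂ) ^ 2 := by
      have := EuclideanSpace.real_norm_sq_eq x
      rw [Fin.sum_univ_three] at this
      exact_mod_cast this
    have hI := Complex.I_sq
    unfold rad
    push_cast
    rw [mul_pow, hn]
    linear_combination
      (4 * (Real.pi : ℂ) ^ 2 * ((x 0 : ℂ) ^ 2 + (x 1 : ℂ) ^ 2 + (x 2 : ℂ) ^ 2) * ψ x) * hI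

theorem mem_negLaplacianGraph_iff (v w : L2H) :
    (v, w) ∈ negLaplacianGraph ↔
      ft w =ᵐ[volume] fun ξ => ((rad ξ ^ 2 : ℝ) : ℂ) • ft v ξ := by
  let A : 𝓢(E3, ℂ) →ₗ[ℂ] HC :=
    cpair (fun x => cplx (v x)) (memLp_ccoord_cplx v) ∘ₗ
        (LineDeriv.laplacianCLM ℂ E3 𝓢(E3, ℂ)).toLinearMap +
    cpair (fun x => cplx (w x)) (memLp_ccoord_cplx w)
  have hA (ψ : 𝓢(E3, ℂ)) : A ψ =
      cpair (fun x => cplx (v x)) (memLp_ccoord_cplx v) (Δ ψ) +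
        cpair (fun x => cplx (w x)) (memLp_ccoord_cplx w) ψ := by
    simp [A]
  have h1 : (v, w) ∈ negLaplacianGraph ↔
      ∀ φ : 𝓢(E3, ℝ), A (φ.postcompCLM Complex.ofRealCLM) = 0 := by
    refine forall_congr' fun φ => ?_
    rw [hA, ← cplx_injective.eq_iff, ← sub_eq_zero, map_neg, sub_neg_eq_add]
    simp only [cplx_pairing, laplacian_ofReal]
  have h2 : (∀ φ : 𝓢(E3, ℝ), A (φ.postcompCLM Complex.ofRealCLM) = 0) ↔
      ∀ ψ : 𝓢(E3, ℂ), A (𝓕 ψ) = 0 := by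
    refine ⟨fun h ψ => linearMap_schwartz_eq_zero h _, fun h φ => ?_⟩
    have := h (𝓕⁻ (φ.postcompCLM Complex.ofRealCLM : 𝓢(E3, ℂ)))
    rwa [FourierTransform.fourier_fourierInv_eq] at this
  have h4 : (ft w =ᵐ[volume] fun ξ => ((rad ξ ^ 2 : ℝ) : ℂ) • ft v ξ) ↔
      ft w =ᵐ[volume] fun ξ => (((rad ξ ^ 2 : ℝ) : ℂ) • (1 : HC)) * ft v ξ := by
    simp only [smul_mul_assoc, one_mul]
  have hc (k : Fin 4) : Continuous fun ξ => ccoord k (((rad ξ ^ 2 : ℝ) : ℂ) • (1 : HC)) := by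
    simp only [map_smul, rad]
    fun_prop
  rw [h1, h2, h4, ft_eq_iff_forall_integral hc]
  refine forall_congr' fun ψ => ?_
  obtain ⟨χ, hχ, hχ'⟩ := laplacian_fourier ψ
  have h3 (k : Fin 4) : ccoord k (A (𝓕 ψ)) = ∫ ξ, ψ ξ * (ccoord k (ft w ξ) -
      ccoord k ((((rad ξ ^ 2 : ℝ) : ℂ) • (1 : HC)) * ft v ξ)) := by
    rw [hA, hχ, cpair_fourier, cpair_fourier, map_add, ccoord_cpair, ccoord_cpair,
      ← integral_add (integrable_schwartz_mul χ (memLp_ccoord_ft k v))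
        (integrable_schwartz_mul ψ (memLp_ccoord_ft k w))]
    refine integral_congr_ae (ae_of_all _ fun ξ => ?_)
    simp only [hχ', smul_mul_assoc, one_mul, map_smul, smul_eq_mul]
    ring
  refine ⟨fun h k => by rw [← h3, h, map_zero], fun h => ext_ccoord fun k => ?_⟩
  rw [h3, h, map_zero]

theorem mem_fracLaplacianGraph_iff (β : ℝ) (v w : L2H) :
    (v, w) ∈ fracLaplacianGraph β ↔
      ft w =ᵐ[volume] fun ξ => ((rad ξ ^ (2 * β) : ℝ) : ℂ) • ft v ξ := by
  constructor
  · intro h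
    have h' (k : Fin 4) : (𝓕 (cplxComp k w) : Lp ℂ 2 (volume : Measure E3)) =ᵐ[volume]
        fun ξ => ((rad ξ ^ (2 * β) : ℝ) : ℂ) *
          (𝓕 (cplxComp k v) : Lp ℂ 2 (volume : Measure E3)) ξ := h k
    filter_upwards [ae_all_iff.2 h'] with ξ hξ
    refine ext_ccoord fun k => ?_
    rw [map_smul, ccoord_ft, ccoord_ft, hξ, smul_eq_mul]
  · intro h k
    change (𝓕 (cplxComp k w) : Lp ℂ 2 (volume : Measure E3)) =ᵐ[volume]
        fun ξ => ((rad ξ ^ (2 * β) : ℝ) : ℂ) *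
          (𝓕 (cplxComp k v) : Lp ℂ 2 (volume : Measure E3)) ξ
    filter_upwards [h] with ξ hξ
    rw [← ccoord_ft, ← ccoord_ft, hξ, map_smul, smul_eq_mul]

/-! ### Hermitian symmetry and the existence of Fourier multipliers -/

/-- The complex conjugate of `ψ̂` is the Fourier transform of `x ↦ conj (ψ (-x))`. -/
theorem conj_fourier_schwartz (ψ : 𝓢(E3, ℂ)) : ∃ χ : 𝓢(E3, ℂ),
    (∀ x, χ x = starRingEnd ℂ (ψ (-x))) ∧ ∀ y, (𝓕 χ) y = starRingEnd ℂ ((𝓕 ψ) y) := by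
  let χ : 𝓢(E3, ℂ) := (SchwartzMap.compCLMOfContinuousLinearEquiv ℂ
    (LinearIsometryEquiv.neg ℝ (E := E3)).toContinuousLinearEquiv ψ).postcompCLM
      (Complex.conjCLE : ℂ →L[ℝ] ℂ)
  have hχ (x : E3) : χ x = starRingEnd ℂ (ψ (-x)) := rfl
  refine ⟨χ, hχ, fun y => ?_⟩
  rw [SchwartzMap.fourier_coe, SchwartzMap.fourier_coe, Real.fourier_eq', Real.fourier_eq',
    ← integral_conj, ← integral_neg_eq_self]
  refine integral_congr_ae (ae_of_all _ fun x => ?_)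
  simp only [hχ, neg_neg, smul_eq_mul, map_mul, ← Complex.exp_conj, inner_neg_left]
  congr 2
  simp
  exact Or.inl (map_ofNat (starRingEnd ℂ) 2).symm

/-- The pointwise complex conjugate of an element of `L²(ℝ³, ℂ)`. -/
def conjLp (f : Lp ℂ 2 (volume : Measure E3)) : Lp ℂ 2 (volume : Measure E3) :=
  (Complex.conjCLE : ℂ →L[ℝ] ℂ).compLp f

theorem coeFn_conjLp (f : Lp ℂ 2 (volume : Measure E3)) :
    conjLp f =ᵐ[volume] fun x => starRingEnd ℂ (f x) :=
  (Complex.conjCLE : ℂ →L[ℝ] ℂ).coeFn_compLp f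

theorem memLp_comp_neg {f : E3 → ℂ} (hf : MemLp f 2 (volume : Measure E3)) :
    MemLp (fun x => f (-x)) 2 (volume : Measure E3) :=
  hf.comp_measurePreserving (Measure.measurePreserving_neg volume)

theorem ae_comp_neg {p : E3 → Prop} (h : ∀ᵐ x ∂(volume : Measure E3), p x) :
    ∀ᵐ x ∂(volume : Measure E3), p (-x) :=
  (Measure.measurePreserving_neg (volume : Measure E3)).quasiMeasurePreserving.ae h

/-- On `L²`, the Fourier transform of `f̄` is `ξ ↦ conj (f̂ (-ξ))`. -/
theorem fourier_conjLp (f : Lp ℂ 2 (volume : Measure E3)) :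
    (𝓕 (conjLp f) : Lp ℂ 2 (volume : Measure E3)) =ᵐ[volume]
      fun ξ => starRingEnd ℂ ((𝓕 f : Lp ℂ 2 (volume : Measure E3)) (-ξ)) := by
  have hm : MemLp (fun ξ => starRingEnd ℂ ((𝓕 f : Lp ℂ 2 (volume : Measure E3)) (-ξ))) 2
      (volume : Measure E3) := by
    have h1 := memLp_comp_neg (Lp.memLp (𝓕 f : Lp ℂ 2 (volume : Measure E3)))
    exact h1.star
  have h0 : ∀ᵐ ξ ∂(volume : Measure E3), (𝓕 (conjLp f) : Lp ℂ 2 (volume : Measure E3)) ξ -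
      starRingEnd ℂ ((𝓕 f : Lp ℂ 2 (volume : Measure E3)) (-ξ)) = 0 := by
    refine ae_eq_zero_of_integral_schwartz_mul
      (((Lp.memLp _).sub hm).locallyIntegrable (by norm_num)) fun ψ => ?_
    obtain ⟨χ, hχ, hχ'⟩ := conj_fourier_schwartz ψ
    simp only [mul_sub]
    rw [integral_sub (integrable_schwartz_mul ψ (Lp.memLp _)) (integrable_schwartz_mul ψ hm),
      sub_eq_zero, integral_schwartz_mul_fourier]
    have h2 : ∫ x, ψ x * starRingEnd ℂ ((𝓕 f : Lp ℂ 2 (volume : Measure E3)) (-x)) =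
        starRingEnd ℂ (∫ x, χ x * (𝓕 f : Lp ℂ 2 (volume : Measure E3)) x) := by
      rw [← integral_conj, ← integral_neg_eq_self]
      refine integral_congr_ae (ae_of_all _ fun x => ?_)
      simp [hχ]
    rw [h2, integral_schwartz_mul_fourier, ← integral_conj]
    refine integral_congr_ae ?_
    filter_upwards [coeFn_conjLp f] with x hx
    rw [hx, map_mul, hχ', Complex.conj_conj]
  filter_upwards [h0] with ξ hξ
  exact sub_eq_zero.1 hξ

/-- Fourier transforms of `ℍ`-valued functions have Hermitian symmetry, since the components of
these functions are real. -/
theorem ft_neg_arg (v : L2H) : ∀ᵐ ξ ∂(volume : Measure E3), ft v (-ξ) = cconj (ft v ξ) := by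
  have h (k : Fin 4) : conjLp (cplxComp k v) = cplxComp k v := by
    refine Lp.ext ?_
    filter_upwards [coeFn_conjLp (cplxComp k v), coeFn_cplxComp k v] with x h1 h2
    rw [h1, h2, Complex.conj_ofReal]
  have h' (k : Fin 4) := fourier_conjLp (cplxComp k v)
  simp only [h] at h'
  filter_upwards [ae_all_iff.2 h'] with ξ hξ
  refine ext_ccoord fun k => ?_
  rw [ccoord_cconj, ccoord_ft, ccoord_ft, hξ, Complex.conj_conj]

/-- The map `z ↦ Re(z) e_k` from `ℂ` to `ℍ`. -/
def reBasis (k : Fin 4) : ℂ →L[ℝ] ℍ[ℝ] :=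
  (ContinuousLinearMap.toSpanSingleton ℝ (basisH k)) ∘L Complex.reCLM

theorem coord_reBasis (k j : Fin 4) (z : ℂ) : coord k (reBasis j z) = if j = k then z.re else 0 := by
  have h1 : reBasis j z = z.re • basisH j := rfl
  have h2 : coord k (basisH j) = if j = k then 1 else 0 := by
    fin_cases k <;> fin_cases j <;> rfl
  rw [h1, map_smul, h2]
  split_ifs <;> simp

theorem coeFn_sum_compLp (f : Fin 4 → Lp ℂ 2 (volume : Measure E3)) :
    (∑ j, (reBasis j).compLp (f j) : L2H) =ᵐ[volume] fun x => ∑ j, reBasis j (f j x) := by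
  have h (s : Finset (Fin 4)) : (∑ j ∈ s, (reBasis j).compLp (f j) : L2H) =ᵐ[volume]
      fun x => ∑ j ∈ s, reBasis j (f j x) := by
    induction s using Finset.induction_on with
    | empty =>
      simp only [Finset.sum_empty]
      exact Lp.coeFn_zero ℍ[ℝ] 2 (volume : Measure E3)
    | insert a s ha ih =>
      rw [Finset.sum_insert ha]
      filter_upwards [ih, (reBasis a).coeFn_compLp (f a),
        Lp.coeFn_add ((reBasis a).compLp (f a)) (∑ j ∈ s, (reBasis j).compLp (f j))]
        with x h1 h2 h3
      rw [h3, Pi.add_apply, h1, h2, Finset.sum_insert ha]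
  exact h Finset.univ

theorem cplxComp_sum_compLp (f : Fin 4 → Lp ℂ 2 (volume : Measure E3)) (k : Fin 4) :
    cplxComp k (∑ j, (reBasis j).compLp (f j)) =ᵐ[volume] fun x => ((f k x).re : ℂ) := by
  filter_upwards [coeFn_cplxComp k (∑ j, (reBasis j).compLp (f j)), coeFn_sum_compLp f]
    with x h1 h2
  rw [h1, h2, map_sum]
  simp [coord_reBasis]

/-- Reassembling `w` from its components. -/
theorem eq_sum_compLp (w : L2H) : w = ∑ j, (reBasis j).compLp (cplxComp j w) := by
  rw [← sub_eq_zero]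
  refine eq_zero_of_cplxComp fun k => ?_
  rw [sub_eq_add_neg, cplxComp_add]
  have hneg : cplxComp k (-∑ j, (reBasis j).compLp (cplxComp j w)) =
      -cplxComp k (∑ j, (reBasis j).compLp (cplxComp j w)) :=
    map_neg ((Complex.ofRealCLM ∘L coord k).compLpₗ 2 (volume : Measure E3)) _
  rw [hneg, ← sub_eq_add_neg, sub_eq_zero]
  refine Lp.ext ?_
  filter_upwards [cplxComp_sum_compLp (fun j => cplxComp j w) k, coeFn_cplxComp k w] with x h1 h2
  rw [h1, h2, Complex.ofReal_re]

/-- A square-integrable function is the Fourier transform of an element of `L²(ℝ³, ℍ)` as soon as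
it has the Hermitian symmetry `u(-ξ) = conj u(ξ)`. -/
theorem exists_ft_eq {u : E3 → HC} (hu : ∀ k, MemLp (fun ξ => ccoord k (u ξ)) 2 volume)
    (hc : ∀ᵐ ξ ∂(volume : Measure E3), u (-ξ) = cconj (u ξ)) : ∃ w : L2H, ft w =ᵐ[volume] u := by
  let g (k : Fin 4) : Lp ℂ 2 (volume : Measure E3) := (hu k).toLp _
  let f (k : Fin 4) : Lp ℂ 2 (volume : Measure E3) := 𝓕⁻ (g k)
  have hf (k : Fin 4) : 𝓕 (f k) = g k := FourierTransform.fourier_fourierInv_eq _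
  have hg (k : Fin 4) : g k =ᵐ[volume] fun ξ => ccoord k (u ξ) := (hu k).coeFn_toLp
  have hreal (k : Fin 4) : conjLp (f k) = f k := by
    apply (Lp.fourierTransformₗᵢ E3 ℂ).injective
    change 𝓕 (conjLp (f k)) = 𝓕 (f k)
    refine Lp.ext ?_
    filter_upwards [fourier_conjLp (f k), hc, hf k ▸ hg k, ae_comp_neg (hg k)] with ξ h1 h2 h3 h4
    rw [h1, h3, hf, h4, h2, ccoord_cconj, Complex.conj_conj]
  -- the inverse Fourier transforms are real-valued, so taking real parts loses nothing
  refine ⟨∑ j, (reBasis j).compLp (f j), ?_⟩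
  have hw (k : Fin 4) : cplxComp k (∑ j, (reBasis j).compLp (f j)) = f k := by
    refine Lp.ext ?_
    filter_upwards [cplxComp_sum_compLp f k, hreal k ▸ coeFn_conjLp (f k)] with x h1 h2
    rw [h1]
    exact Complex.conj_eq_iff_re.1 h2.symm
  filter_upwards [ae_all_iff.2 hg] with ξ hξ
  refine ext_ccoord fun k => ?_
  rw [ccoord_ft, hw, hf, hξ]

/-- A symbol: a measurable function with the Hermitian symmetry `a(-ξ) = conj a(ξ)`, so that
multiplication by it preserves Fourier transforms of `ℍ`-valued functions. -/
structure IsSymbol (a : E3 → HC) : Prop where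
  measurable : ∀ k, Measurable fun ξ => ccoord k (a ξ)
  neg_arg : ∀ ξ, a (-ξ) = cconj (a ξ)

theorem measurable_ccoord_mul {a b : E3 → HC} (ha : ∀ k, Measurable fun ξ => ccoord k (a ξ))
    (hb : ∀ k, Measurable fun ξ => ccoord k (b ξ)) (k : Fin 4) :
    Measurable fun ξ => ccoord k (a ξ * b ξ) := by
  have h (ξ : E3) : ccoord k (a ξ * b ξ) = ∑ i, ∑ j, ccoord i (a ξ) * ccoord j (b ξ) *
      ccoord k (cplx (basisH i) * cplx (basisH j)) := by
    conv_lhs => rw [ccoord_basis (a ξ), ccoord_basis (b ξ)]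
    simp only [Finset.sum_mul, Finset.mul_sum, smul_mul_assoc, mul_smul_comm, map_sum, map_smul,
      smul_eq_mul]
    rw [Finset.sum_comm]
    exact Finset.sum_congr rfl fun i _ => Finset.sum_congr rfl fun j _ => by ring
  simp only [h]
  have (k : Fin 4) := ha k
  have (k : Fin 4) := hb k
  fun_prop

theorem IsSymbol.add {a b : E3 → HC} (ha : IsSymbol a) (hb : IsSymbol b) :
    IsSymbol fun ξ => a ξ + b ξ :=
  ⟨fun k => by simp only [map_add]; exact (ha.1 k).add (hb.1 k),
    fun ξ => by rw [ha.2, hb.2, cconj_add]⟩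

theorem IsSymbol.smul {m : E3 → ℝ} {a : E3 → HC} (hm : Measurable m) (hm' : ∀ ξ, m (-ξ) = m ξ)
    (ha : IsSymbol a) : IsSymbol fun ξ => (m ξ : ℂ) • a ξ :=
  ⟨fun k => by
    simp only [map_smul, smul_eq_mul]
    exact (Complex.measurable_ofReal.comp hm).mul (ha.1 k),
    fun ξ => by rw [ha.2, hm', cconj_ofReal_smul]⟩

theorem isSymbol_one : IsSymbol fun _ => 1 :=
  ⟨fun _ => measurable_const, fun _ => cconj_one.symm⟩

theorem isSymbol_symD : IsSymbol symD := by
  refine ⟨fun k => (continuous_ccoord_symD k).measurable, fun ξ => ext_ccoord fun k => ?_⟩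
  simp only [symD, ccoord_cconj, map_sum, map_smul, smul_eq_mul, map_mul, ccoord_cplx,
    Complex.conj_ofReal, Complex.conj_I, map_ofNat, PiLp.neg_apply]
  refine Finset.sum_congr rfl fun i _ => ?_
  push_cast
  ring

theorem memLp_sn_ft (v : L2H) : MemLp (fun ξ => sn (ft v ξ)) 2 (volume : Measure E3) := by
  simp only [sn_eq_sum]
  exact memLp_finsetSum _ fun k _ => (memLp_ccoord_ft k v).norm

theorem aestronglyMeasurable_ccoord_mul_ft {a : E3 → HC}
    (ha : ∀ k, Measurable fun ξ => ccoord k (a ξ)) (v : L2H) (k : Fin 4) :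
    AEStronglyMeasurable (fun ξ => ccoord k (a ξ * ft v ξ)) (volume : Measure E3) := by
  refine (measurable_ccoord_mul ha (fun j => ?_) k).aestronglyMeasurable
  simp only [ccoord_ft]
  exact (Lp.stronglyMeasurable _).measurable

/-- The multiplier with symbol `a` is defined at `v` when `a v̂` is dominated by Fourier transforms
of elements of `L²(ℝ³, ℍ)`. -/
theorem exists_multiplier {a : E3 → HC} (ha : IsSymbol a) (v v₁ v₂ : L2H) (K : ℝ)
    (h : ∀ᵐ ξ ∂(volume : Measure E3), sn (a ξ * ft v ξ) ≤ K * (sn (ft v₁ ξ) + sn (ft v₂ ξ))) :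
    ∃ w : L2H, ft w =ᵐ[volume] fun ξ => a ξ * ft v ξ := by
  refine exists_ft_eq (fun k => ?_) ?_
  · refine MemLp.mono' (((memLp_sn_ft v₁).add (memLp_sn_ft v₂)).const_mul K)
      (aestronglyMeasurable_ccoord_mul_ft ha.1 v k) ?_
    filter_upwards [h] with ξ hξ
    exact (norm_ccoord_le k _).trans hξ
  · filter_upwards [ft_neg_arg v] with ξ hξ
    rw [ha.2, hξ, cconj_mul]

/-- Pointwise bounds between Fourier transforms give norm bounds, up to a constant. -/
theorem exists_norm_le_of_sn_ft_le : ∃ C : ℝ, 0 ≤ C ∧ ∀ (K : ℝ), 0 ≤ K → ∀ v w : L2H,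
    (∀ᵐ ξ ∂(volume : Measure E3), sn (ft w ξ) ≤ K * sn (ft v ξ)) → ‖w‖ ≤ C * K * ‖v‖ := by
  let A : ℝ := ∑ j, ‖reBasis j‖
  let B : ℝ := ∑ j, ‖Complex.ofRealCLM ∘L coord j‖
  refine ⟨A * B, by positivity, fun K hK v w h => ?_⟩
  -- `G = sn (ft v)` is the sum of the norms `g j` of the coordinates of `ft v`, each of which is
  -- controlled by Plancherel
  let g (j : Fin 4) : Lp ℝ 2 (volume : Measure E3) := (memLp_ccoord_ft j v).norm.toLp _
  have hg (j : Fin 4) : g j =ᵐ[volume] fun ξ => ‖ccoord j (ft v ξ)‖ :=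
    (memLp_ccoord_ft j v).norm.coeFn_toLp
  let G : Lp ℝ 2 (volume : Measure E3) := (memLp_sn_ft v).toLp _
  have hG : G =ᵐ[volume] fun ξ => sn (ft v ξ) := (memLp_sn_ft v).coeFn_toLp
  have hGg : G = ∑ j, g j := by
    refine Lp.ext ?_
    rw [Fin.sum_univ_four]
    filter_upwards [hG, ae_all_iff.2 hg, Lp.coeFn_add (g 0 + g 1 + g 2) (g 3),
      Lp.coeFn_add (g 0 + g 1) (g 2), Lp.coeFn_add (g 0) (g 1)] with ξ h1 h2 h3 h4 h5
    rw [h1, h3, Pi.add_apply, h4, Pi.add_apply, h5, Pi.add_apply, sn_eq_sum, Fin.sum_univ_four]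
    simp only [h2]
  have hnorm (j : Fin 4) (u : L2H) :
      ‖(𝓕 (cplxComp j u) : Lp ℂ 2 (volume : Measure E3))‖ = ‖cplxComp j u‖ :=
    Lp.norm_fourier_eq _
  have hgj (j : Fin 4) : ‖g j‖ ≤ ‖Complex.ofRealCLM ∘L coord j‖ * ‖v‖ := by
    have h1 : ‖g j‖ ≤ ‖(𝓕 (cplxComp j v) : Lp ℂ 2 (volume : Measure E3))‖ := by
      refine Lp.norm_le_norm_of_ae_le ?_
      filter_upwards [hg j] with ξ hξ
      rw [hξ, norm_norm, ccoord_ft]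
    rw [hnorm] at h1
    exact h1.trans (ContinuousLinearMap.norm_compLp_le _ _)
  have hGn : ‖G‖ ≤ B * ‖v‖ := by
    rw [hGg, Finset.sum_mul]
    exact (norm_sum_le _ _).trans (Finset.sum_le_sum fun j _ => hgj j)
  have hk (k : Fin 4) : ‖cplxComp k w‖ ≤ K * (B * ‖v‖) := by
    rw [← hnorm]
    refine (Lp.norm_le_mul_norm_of_ae_le_mul (c := K) (g := G) ?_).trans
      (mul_le_mul_of_nonneg_left hGn hK)
    filter_upwards [hG, h] with ξ h1 h2
    rw [← ccoord_ft, h1, Real.norm_of_nonneg (sn_nonneg _)]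
    exact (norm_ccoord_le k _).trans h2
  calc ‖w‖ = ‖∑ j, (reBasis j).compLp (cplxComp j w)‖ := by rw [← eq_sum_compLp]
    _ ≤ ∑ j, ‖reBasis j‖ * (K * (B * ‖v‖)) := by
      refine (norm_sum_le _ _).trans (Finset.sum_le_sum fun j _ => ?_)
      exact (ContinuousLinearMap.norm_compLp_le _ _).trans
        (mul_le_mul_of_nonneg_left (hk j) (norm_nonneg _))
    _ = A * B * K * ‖v‖ := by rw [← Finset.sum_mul]; ring

/-- A bounded symbol defines a bounded right-linear operator. -/
theorem exists_bounded_multiplier {a : E3 → HC} (ha : IsSymbol a) {K : ℝ}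
    (hK : ∀ ξ, sn (a ξ) ≤ K) :
    ∃ B : L2H →L[ℍ[ℝ]ᵐᵒᵖ] L2H, ∀ v, ft (B v) =ᵐ[volume] fun ξ => a ξ * ft v ξ := by
  have hK0 : 0 ≤ K := (sn_nonneg _).trans (hK 0)
  have hle (v : L2H) (ξ : E3) : sn (a ξ * ft v ξ) ≤ K * sn (ft v ξ) :=
    (sn_mul_le _ _).trans (mul_le_mul_of_nonneg_right (hK ξ) (sn_nonneg _))
  have hex (v : L2H) : ∃ w : L2H, ft w =ᵐ[volume] fun ξ => a ξ * ft v ξ := by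
    refine exists_multiplier ha v v v K (ae_of_all _ fun ξ => (hle v ξ).trans ?_)
    exact mul_le_mul_of_nonneg_left (le_add_of_nonneg_left (sn_nonneg _)) hK0
  choose f hf using hex
  let F : L2H →ₗ[ℍ[ℝ]ᵐᵒᵖ] L2H :=
    { toFun := f
      map_add' := fun v w => eq_of_ft_eq <| by
        filter_upwards [hf (v + w), hf v, hf w, ft_add v w, ft_add (f v) (f w)]
          with ξ h1 h2 h3 h4 h5
        rw [h1, h5, h4, h2, h3, mul_add]
      map_smul' := fun c v => eq_of_ft_eq <| by
        filter_upwards [hf (c • v), hf v, ft_op_smul c v, ft_op_smul c (f v)] with ξ h1 h2 h3 h4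
        rw [RingHom.id_apply, h1, h4, h3, h2, mul_assoc] }
  obtain ⟨C, hC, hCb⟩ := exists_norm_le_of_sn_ft_le
  refine ⟨⟨F, AddMonoidHomClass.continuous_of_bound F (C * K) fun v => hCb K hK0 v (f v) ?_⟩, hf⟩
  filter_upwards [hf v] with ξ hξ
  rw [hξ]
  exact hle v ξ

/-! ### The operators `∇`, `∇²` and `(-Δ)^β` on the Fourier side -/

theorem exists_apply_eq_of_mem_graph {T : Op} {v w : L2H} (h : (v, w) ∈ T.graph) :
    ∃ hv : v ∈ T.domain, T ⟨v, hv⟩ = w := by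
  obtain ⟨⟨y, hy⟩, rfl, h2⟩ := (LinearPMap.mem_graph_iff T).1 h
  exact ⟨hy, h2⟩

theorem ft_nabla {v : L2H} (hv : v ∈ nabla.domain) :
    ft (nabla ⟨v, hv⟩) =ᵐ[volume] fun ξ => symD ξ * ft v ξ := by
  rw [← mem_nablaGraph_iff, ← graph_nabla]
  exact nabla.mem_graph ⟨v, hv⟩

theorem nabla_apply_eq {v w : L2H} (h : ft w =ᵐ[volume] fun ξ => symD ξ * ft v ξ) :
    ∃ hv : v ∈ nabla.domain, nabla ⟨v, hv⟩ = w :=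
  exists_apply_eq_of_mem_graph (by rwa [graph_nabla, mem_nablaGraph_iff])

theorem ft_negLaplacian {v : L2H} (hv : v ∈ negLaplacian.domain) :
    ft (negLaplacian ⟨v, hv⟩) =ᵐ[volume] fun ξ => ((rad ξ ^ 2 : ℝ) : ℂ) • ft v ξ := by
  rw [← mem_negLaplacianGraph_iff, ← graph_negLaplacian]
  exact negLaplacian.mem_graph ⟨v, hv⟩

theorem negLaplacian_apply_eq {v w : L2H}
    (h : ft w =ᵐ[volume] fun ξ => ((rad ξ ^ 2 : ℝ) : ℂ) • ft v ξ) :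
    ∃ hv : v ∈ negLaplacian.domain, negLaplacian ⟨v, hv⟩ = w :=
  exists_apply_eq_of_mem_graph (by rwa [graph_negLaplacian, mem_negLaplacianGraph_iff])

theorem fracLaplacian_apply_eq {β : ℝ} {v w : L2H}
    (h : ft w =ᵐ[volume] fun ξ => ((rad ξ ^ (2 * β) : ℝ) : ℂ) • ft v ξ) :
    ∃ hv : v ∈ (fracLaplacian β).domain, fracLaplacian β ⟨v, hv⟩ = w :=
  exists_apply_eq_of_mem_graph (by rwa [graph_fracLaplacian, mem_fracLaplacianGraph_iff])

theorem opComp_apply_eq {A B : Op} {v w x : L2H}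
    (hB : ∃ h : v ∈ B.domain, B ⟨v, h⟩ = w) (hA : ∃ h : w ∈ A.domain, A ⟨w, h⟩ = x) :
    ∃ h : v ∈ (opComp A B).domain, opComp A B ⟨v, h⟩ = x := by
  obtain ⟨h1, rfl⟩ := hB
  obtain ⟨h2, rfl⟩ := hA
  exact ⟨⟨h1, h2⟩, rfl⟩

theorem rad_nonneg (ξ : E3) : 0 ≤ rad ξ := by unfold rad; positivity

theorem measurable_rad : Measurable rad := by unfold rad; fun_prop

theorem rad_neg (ξ : E3) : rad (-ξ) = rad ξ := by simp [rad]

theorem ae_rad_pos : ∀ᵐ ξ ∂(volume : Measure E3), 0 < rad ξ := by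
  have : ∀ᵐ ξ ∂(volume : Measure E3), ξ ≠ 0 := by
    simp [ae_iff]
  filter_upwards [this] with ξ hξ
  have := norm_pos_iff.2 hξ
  unfold rad
  positivity

theorem sn_cplx_e (i : Fin 3) : sn (cplx (e i)) = 1 := by
  have h (a b c d : ℝ) : cplx ⟨a, b, c, d⟩ = ⟨a, b, c, d⟩ := rfl
  fin_cases i <;> simp [e, h, sn]

theorem sn_symD_le (ξ : E3) : sn (symD ξ) ≤ 3 * rad ξ := by
  have h (i : Fin 3) : sn ((2 * Real.pi * Complex.I * (ξ i : ℝ)) • cplx (e i)) ≤ rad ξ := by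
    rw [sn_smul, sn_cplx_e, mul_one]
    simp only [Complex.norm_mul, Complex.norm_ofNat, Complex.norm_real, Complex.norm_I, mul_one,
      Real.norm_of_nonneg Real.pi_pos.le, rad]
    exact mul_le_mul_of_nonneg_left (PiLp.norm_apply_le ξ i) (by positivity)
  unfold symD
  rw [Fin.sum_univ_three]
  linarith [h 0, h 1, h 2, sn_add_le ((2 * Real.pi * Complex.I * (ξ 0 : ℝ)) • cplx (e 0) +
    (2 * Real.pi * Complex.I * (ξ 1 : ℝ)) • cplx (e 1))
    ((2 * Real.pi * Complex.I * (ξ 2 : ℝ)) • cplx (e 2)),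
    sn_add_le ((2 * Real.pi * Complex.I * (ξ 0 : ℝ)) • cplx (e 0))
      ((2 * Real.pi * Complex.I * (ξ 1 : ℝ)) • cplx (e 1))]

theorem sn_symD_mul_le (ξ : E3) (x : HC) : sn (symD ξ * x) ≤ 3 * rad ξ * sn x :=
  (sn_mul_le _ _).trans (mul_le_mul_of_nonneg_right (sn_symD_le ξ) (sn_nonneg _))

theorem symD_mul_symD_mul (ξ : E3) (x : HC) :
    symD ξ * (symD ξ * x) = ((rad ξ ^ 2 : ℝ) : ℂ) • x := by
  rw [← mul_assoc, symD_mul_symD, smul_mul_assoc, one_mul]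

/-- Elements of `𝒟(-Δ)` lie in `𝒟(∇)`, since `2π|ξ| ≤ 1 + (2π|ξ|)²`. -/
theorem exists_ft_eq_symD_mul {v w : L2H}
    (h : ft w =ᵐ[volume] fun ξ => ((rad ξ ^ 2 : ℝ) : ℂ) • ft v ξ) :
    ∃ u : L2H, ft u =ᵐ[volume] fun ξ => symD ξ * ft v ξ := by
  refine exists_multiplier isSymbol_symD v v w 3 ?_
  filter_upwards [h] with ξ hξ
  rw [hξ, sn_smul, Complex.norm_real, Real.norm_of_nonneg (sq_nonneg _)]
  have h1 := sn_nonneg (ft v ξ)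
  refine (sn_symD_mul_le ξ _).trans ?_
  nlinarith [mul_nonneg h1 (sq_nonneg (rad ξ - 1)), mul_nonneg h1 (rad_nonneg ξ)]

theorem opComp_nabla_nabla : opComp nabla nabla = negLaplacian := by
  refine LinearPMap.eq_of_eq_graph (SetLike.ext fun ⟨v, w⟩ => ?_)
  rw [graph_negLaplacian, mem_negLaplacianGraph_iff]
  constructor
  · intro h
    obtain ⟨⟨h1, h2⟩, rfl⟩ := exists_apply_eq_of_mem_graph h
    filter_upwards [ft_nabla h2, ft_nabla h1] with ξ e1 e2
    refine Eq.trans e1 ?_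
    rw [e2, symD_mul_symD_mul]
  · intro h
    obtain ⟨u, hu⟩ := exists_ft_eq_symD_mul h
    have hw : ft w =ᵐ[volume] fun ξ => symD ξ * ft u ξ := by
      filter_upwards [h, hu] with ξ e1 e2
      rw [e1, e2, symD_mul_symD_mul]
    obtain ⟨h1, h2⟩ := opComp_apply_eq (nabla_apply_eq hu) (nabla_apply_eq hw)
    exact (LinearPMap.mem_graph_iff _).2 ⟨⟨v, h1⟩, rfl, h2⟩

theorem nabla_apply_of_mem_negLaplacian {v : L2H} (hv : v ∈ negLaplacian.domain) :
    ∃ h : v ∈ nabla.domain, nabla ⟨v, h⟩ ∈ nabla.domain := by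
  rw [← opComp_nabla_nabla] at hv
  exact hv

/-! ### The `S`-resolvent of `∇` on the imaginary axis -/

/-- The symbol `1 / (t² + (2π|ξ|)²)` of `(t² - Δ)⁻¹`. -/
def resSym (t : ℝ) (ξ : E3) : ℝ := (t ^ 2 + rad ξ ^ 2)⁻¹

theorem resSym_nonneg (t : ℝ) (ξ : E3) : 0 ≤ resSym t ξ := by unfold resSym; positivity

theorem resSym_le {t : ℝ} (ht : t ≠ 0) (ξ : E3) : resSym t ξ ≤ (t ^ 2)⁻¹ := by
  unfold resSym
  have : 0 < t ^ 2 := by positivity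
  gcongr
  linarith [sq_nonneg (rad ξ)]

theorem rad_mul_resSym_le {t : ℝ} (ht : t ≠ 0) (ξ : E3) : rad ξ * resSym t ξ ≤ |t|⁻¹ := by
  unfold resSym
  have h : 0 < |t| := abs_pos.2 ht
  rw [← sq_abs t, ← div_eq_mul_inv, div_le_iff₀ (by positivity), inv_mul_eq_div,
    le_div_iff₀ h]
  nlinarith [sq_nonneg (rad ξ - |t|), rad_nonneg ξ]

theorem rad_sq_mul_resSym_le (t : ℝ) (ξ : E3) : rad ξ ^ 2 * resSym t ξ ≤ 1 := by
  unfold resSym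
  rw [← div_eq_mul_inv]
  exact div_le_one_of_le₀ (by linarith [sq_nonneg t]) (by positivity)

theorem measurable_resSym (t : ℝ) : Measurable (resSym t) := by
  have := measurable_rad
  unfold resSym
  fun_prop

theorem isSymbol_resSym (t : ℝ) : IsSymbol fun ξ => (resSym t ξ : ℂ) • (1 : HC) :=
  isSymbol_one.smul (measurable_resSym t) fun ξ => by simp [resSym, rad_neg]

theorem isSymbol_resSym_symD (t : ℝ) : IsSymbol fun ξ => (resSym t ξ : ℂ) • symD ξ :=
  isSymbol_symD.smul (measurable_resSym t) fun ξ => by simp [resSym, rad_neg]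

theorem sn_one : sn 1 = 1 := by simp [sn]

theorem sn_resSym_smul (t : ℝ) (ξ : E3) (x : HC) :
    sn ((resSym t ξ : ℂ) • x) = resSym t ξ * sn x := by
  rw [sn_smul, Complex.norm_real, Real.norm_of_nonneg (resSym_nonneg t ξ)]

theorem exists_resLap {t : ℝ} (ht : t ≠ 0) : ∃ B : L2H →L[ℍ[ℝ]ᵐᵒᵖ] L2H,
    ∀ v, ft (B v) =ᵐ[volume] fun ξ => (resSym t ξ : ℂ) • ft v ξ := by
  obtain ⟨B, hB⟩ := exists_bounded_multiplier (isSymbol_resSym t) (K := (t ^ 2)⁻¹) fun ξ => by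
    rw [sn_resSym_smul, sn_one, mul_one]
    exact resSym_le ht ξ
  refine ⟨B, fun v => ?_⟩
  filter_upwards [hB v] with ξ hξ
  rw [hξ, smul_mul_assoc, one_mul]

theorem exists_resNabla {t : ℝ} (ht : t ≠ 0) : ∃ B : L2H →L[ℍ[ℝ]ᵐᵒᵖ] L2H,
    ∀ v, ft (B v) =ᵐ[volume] fun ξ => (resSym t ξ : ℂ) • (symD ξ * ft v ξ) := by
  obtain ⟨B, hB⟩ := exists_bounded_multiplier (isSymbol_resSym_symD t) (K := 3 * |t|⁻¹)
    fun ξ => by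
      rw [sn_resSym_smul]
      have := mul_le_mul_of_nonneg_left (sn_symD_le ξ) (resSym_nonneg t ξ)
      linarith [rad_mul_resSym_le ht ξ]
  refine ⟨B, fun v => ?_⟩
  filter_upwards [hB v] with ξ hξ
  rw [hξ, smul_mul_assoc]

open Classical in
/-- The resolvent `(t² - Δ)⁻¹`, for `t ≠ 0`. -/
def resLap (t : ℝ) : L2H →L[ℍ[ℝ]ᵐᵒᵖ] L2H :=
  if ht : t ≠ 0 then (exists_resLap ht).choose else 0

open Classical in
/-- The bounded operator `∇ (t² - Δ)⁻¹`, for `t ≠ 0`. -/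
def resNabla (t : ℝ) : L2H →L[ℍ[ℝ]ᵐᵒᵖ] L2H :=
  if ht : t ≠ 0 then (exists_resNabla ht).choose else 0

theorem ft_resLap {t : ℝ} (ht : t ≠ 0) (v : L2H) :
    ft (resLap t v) =ᵐ[volume] fun ξ => (resSym t ξ : ℂ) • ft v ξ := by
  rw [resLap, dif_pos ht]
  exact (exists_resLap ht).choose_spec v

theorem ft_resNabla {t : ℝ} (ht : t ≠ 0) (v : L2H) :
    ft (resNabla t v) =ᵐ[volume] fun ξ => (resSym t ξ : ℂ) • (symD ξ * ft v ξ) := by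
  rw [resNabla, dif_pos ht]
  exact (exists_resNabla ht).choose_spec v

theorem resSym_smul_add {t : ℝ} (ht : t ≠ 0) (ξ : E3) (x : HC) :
    (resSym t ξ : ℂ) • (((rad ξ ^ 2 : ℝ) : ℂ) • x + ((t ^ 2 : ℝ) : ℂ) • x) = x := by
  have : 0 < t ^ 2 + rad ξ ^ 2 := by positivity
  rw [← add_smul, smul_smul]
  have h : (resSym t ξ : ℂ) * (((rad ξ ^ 2 : ℝ) : ℂ) + ((t ^ 2 : ℝ) : ℂ)) = 1 := by
    rw [← Complex.ofReal_add, ← Complex.ofReal_mul, add_comm, resSym,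
      inv_mul_cancel₀ this.ne', Complex.ofReal_one]
  rw [h, one_smul]

section ImaginaryUnit

variable {I : ℍ[ℝ]}

theorem re_eq_zero_of_mul_self (hI : I * I = -1) : I.re = 0 := by
  have h0 := congrArg QuaternionAlgebra.re hI
  have h1 := congrArg QuaternionAlgebra.imI hI
  have h2 := congrArg QuaternionAlgebra.imJ hI
  have h3 := congrArg QuaternionAlgebra.imK hI
  simp at h0 h1 h2 h3
  by_contra h
  have e1 : I.imI = 0 := by
    have : I.re * I.imI = 0 := by linarith
    exact (mul_eq_zero.1 this).resolve_left h
  have e2 : I.imJ = 0 := by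
    have : I.re * I.imJ = 0 := by linarith
    exact (mul_eq_zero.1 this).resolve_left h
  have e3 : I.imK = 0 := by
    have : I.re * I.imK = 0 := by linarith
    exact (mul_eq_zero.1 this).resolve_left h
  rw [e1, e2, e3] at h0
  nlinarith [mul_self_nonneg I.re]

theorem norm_eq_one_of_mul_self (hI : I * I = -1) : ‖I‖ = 1 := by
  have h := congrArg norm hI
  rw [norm_mul, norm_neg, norm_one] at h
  nlinarith [norm_nonneg I]

theorem norm_neg_smul (hI : I * I = -1) (t : ℝ) : ‖-(t • I)‖ = |t| := by
  rw [norm_neg, norm_smul, norm_eq_one_of_mul_self hI, mul_one, Real.norm_eq_abs]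

theorem re_neg_smul (hI : I * I = -1) (t : ℝ) : (-(t • I)).re = 0 := by
  simp [re_eq_zero_of_mul_self hI]

theorem ft_Q (hI : I * I = -1) (t : ℝ) (u : (Q (-(t • I)) nabla).domain) :
    ft (Q (-(t • I)) nabla u) =ᵐ[volume] fun ξ =>
      ((rad ξ ^ 2 : ℝ) : ℂ) • ft (u : L2H) ξ + ((t ^ 2 : ℝ) : ℂ) • ft (u : L2H) ξ := by
  obtain ⟨u, ⟨⟨⟨h1, h2⟩, h3⟩, h4⟩⟩ := u
  have hQ : Q (-(t • I)) nabla ⟨u, ⟨⟨⟨h1, h2⟩, h3⟩, h4⟩⟩ =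
      nabla ⟨nabla ⟨u, h1⟩, h2⟩ - (2 * (-(t • I)).re) • nabla ⟨u, h3⟩ +
        (‖-(t • I)‖ ^ 2) • u := rfl
  rw [hQ, re_neg_smul hI, norm_neg_smul hI, mul_zero, zero_smul, sub_zero, sq_abs]
  filter_upwards [ft_add (nabla ⟨nabla ⟨u, h1⟩, h2⟩) (t ^ 2 • u), ft_real_smul (t ^ 2) u,
    ft_nabla h1, ft_nabla h2] with ξ e1 e2 e3 e4
  rw [e1, e2, e4, e3, symD_mul_symD_mul]

theorem isPseudoResolvent_resLap (hI : I * I = -1) {t : ℝ} (ht : t ≠ 0) :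
    IsPseudoResolvent (-(t • I)) nabla (resLap t) := by
  constructor
  · intro v
    have hw : ft (v - t ^ 2 • resLap t v) =ᵐ[volume] fun ξ =>
        ((rad ξ ^ 2 : ℝ) : ℂ) • ft (resLap t v) ξ := by
      filter_upwards [ft_sub v (t ^ 2 • resLap t v), ft_real_smul (t ^ 2) (resLap t v),
        ft_resLap ht v] with ξ e1 e2 e3
      have e4 := resSym_smul_add ht ξ (ft v ξ)
      rw [smul_add, smul_comm, smul_comm _ ((t ^ 2 : ℝ) : ℂ)] at e4
      rw [e1, e2, e3, sub_eq_iff_eq_add, e4]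
    obtain ⟨h1, h1'⟩ := negLaplacian_apply_eq hw
    obtain ⟨h2, h3⟩ := nabla_apply_of_mem_negLaplacian h1
    refine ⟨⟨⟨⟨h2, h3⟩, h2⟩, trivial⟩, eq_of_ft_eq ?_⟩
    filter_upwards [ft_Q hI t ⟨resLap t v, ⟨⟨⟨h2, h3⟩, h2⟩, trivial⟩⟩, ft_resLap ht v] with ξ e1 e2
    rw [e1, e2, smul_comm, smul_comm _ (resSym t ξ : ℂ), ← smul_add, resSym_smul_add ht]
  · intro u
    refine eq_of_ft_eq ?_
    filter_upwards [ft_resLap ht (Q (-(t • I)) nabla u), ft_Q hI t u] with ξ e1 e2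
    rw [e1, e2, resSym_smul_add ht]

theorem pseudoResolvent_eq_resLap (hI : I * I = -1) {t : ℝ} (ht : t ≠ 0) (v : L2H) :
    pseudoResolvent (-(t • I)) nabla v = resLap t v := by
  have h : ∃ B, IsPseudoResolvent (-(t • I)) nabla B := ⟨_, isPseudoResolvent_resLap hI ht⟩
  obtain ⟨h1, h2⟩ := h.choose_spec.1 v
  rw [pseudoResolvent, dif_pos h]
  conv_rhs => rw [← h2]
  exact ((isPseudoResolvent_resLap hI ht).2 ⟨_, h1⟩).symm

/-- `S_L⁻¹(-It, ∇) = (t² - Δ)⁻¹ t I - ∇ (t² - Δ)⁻¹`. -/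
theorem leftSResolvent_eq (hI : I * I = -1) {t : ℝ} (ht : t ≠ 0) (v : L2H) :
    leftSResolvent (-(t • I)) nabla v = resLap t ((t • I) • v) - resNabla t v := by
  have hs : star (-(t • I)) = t • I := by
    ext <;> simp [re_eq_zero_of_mul_self hI]
  have h1 : leftSResolvent (-(t • I)) nabla v =
      pseudoResolvent (-(t • I)) nabla (star (-(t • I)) • v) -
        nabla ⟨pseudoResolvent (-(t • I)) nabla v, pseudoResolvent_mem _ _ v⟩ := rfl
  have h2 : nabla ⟨pseudoResolvent (-(t • I)) nabla v, pseudoResolvent_mem _ _ v⟩ =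
      resNabla t v := by
    refine eq_of_ft_eq ?_
    filter_upwards [ft_nabla (pseudoResolvent_mem (-(t • I)) nabla v), ft_resNabla ht v,
      ft_resLap ht v] with ξ e1 e2 e3
    rw [e1, e2, pseudoResolvent_eq_resLap hI ht, e3, mul_smul_comm]
  rw [h1, h2, hs, pseudoResolvent_eq_resLap hI ht]

end ImaginaryUnit

/-! ### Integrals on the real line -/

theorem integral_exp_neg_mul_Ioi {c : ℝ} (hc : 0 < c) :
    ∫ u in Set.Ioi (0 : ℝ), Real.exp (-(c * u)) = c⁻¹ := by
  have h := Real.integral_rpow_mul_exp_neg_mul_Ioi (a := 1) (r := c) one_pos hc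
  simpa using h

/-- `∫₀^∞ x^β / (x² + r²) dx`, computed from the representation
`1 / (x² + r²) = ∫₀^∞ exp(-u(x² + r²)) du` and the reflection formula of the Gamma function. -/
theorem integral_Ioi_rpow_mul_inv_sq_add_sq {β r : ℝ} (h1 : -1 < β) (h2 : β < 1) (hr : 0 < r) :
    ∫ x in Set.Ioi (0 : ℝ), x ^ β * (x ^ 2 + r ^ 2)⁻¹ =
      r ^ (β - 1) * (Real.pi / (2 * Real.cos (Real.pi * β / 2))) := by
  let F : ℝ × ℝ → ℝ := fun p => p.1 ^ β * Real.exp (-p.2 * p.1 ^ (2 : ℝ)) *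
    Real.exp (-(r ^ 2 * p.2))
  let μ := (volume : Measure ℝ).restrict (Set.Ioi 0)
  have hFm : Measurable F := by fun_prop
  set G : ℝ := Real.Gamma ((β + 1) / 2)
  have hG : 0 < G := Real.Gamma_pos_of_pos (by linarith)
  have hinner (u : ℝ) (hu : 0 < u) : ∫ x, F (x, u) ∂μ =
      (1 / 2 * G) * (u ^ ((1 - β) / 2 - 1) * Real.exp (-(r ^ 2 * u))) := by
    have h := integral_rpow_mul_exp_neg_mul_rpow (p := 2) two_pos h1 hu
    change ∫ x in Set.Ioi (0 : ℝ), x ^ β * Real.exp (-u * x ^ (2 : ℝ)) *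
      Real.exp (-(r ^ 2 * u)) = _
    rw [integral_mul_const, h]
    have e1 : -(β + 1) / 2 = (1 - β) / 2 - 1 := by ring
    rw [e1]
    ring
  have houter : ∫ u, (1 / 2 * G) * (u ^ ((1 - β) / 2 - 1) * Real.exp (-(r ^ 2 * u))) ∂μ =
      (1 / 2 * G) * ((1 / r ^ 2) ^ ((1 - β) / 2) * Real.Gamma ((1 - β) / 2)) := by
    rw [integral_const_mul, Real.integral_rpow_mul_exp_neg_mul_Ioi (by linarith) (by positivity)]
  have hG' : 0 < Real.Gamma ((1 - β) / 2) := Real.Gamma_pos_of_pos (by linarith)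
  have hpos : ∀ᵐ u ∂μ, 0 < u := by
    filter_upwards [self_mem_ae_restrict measurableSet_Ioi] with u hu using hu
  have hFint : Integrable F (μ.prod μ) := by
    refine (integrable_prod_iff' hFm.aestronglyMeasurable).2 ⟨?_, ?_⟩
    · filter_upwards [hpos] with u hu
      -- the integral of a function that is not integrable would be zero
      refine Integrable.of_integral_ne_zero ?_
      rw [hinner u hu]
      positivity
    · have hi : Integrable
          (fun u => (1 / 2 * G) * (u ^ ((1 - β) / 2 - 1) * Real.exp (-(r ^ 2 * u)))) μ := by
        refine Integrable.of_integral_ne_zero ?_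
        rw [houter]
        positivity
      refine hi.congr ?_
      filter_upwards [hpos] with u hu
      rw [← hinner u hu]
      refine integral_congr_ae ?_
      filter_upwards [hpos] with x hx
      exact (Real.norm_of_nonneg (by positivity)).symm
  have hswap : ∫ x, ∫ u, F (x, u) ∂μ ∂μ = ∫ u, ∫ x, F (x, u) ∂μ ∂μ :=
    integral_integral_swap hFint
  have hleft : ∫ x, ∫ u, F (x, u) ∂μ ∂μ =
      ∫ x in Set.Ioi (0 : ℝ), x ^ β * (x ^ 2 + r ^ 2)⁻¹ := by
    refine integral_congr_ae ?_
    filter_upwards [hpos] with x hx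
    have hc : 0 < x ^ 2 + r ^ 2 := by positivity
    rw [← integral_exp_neg_mul_Ioi hc, ← integral_const_mul]
    refine integral_congr_ae (ae_of_all _ fun u => ?_)
    simp only [F]
    rw [mul_assoc, ← Real.exp_add, Real.rpow_two]
    ring_nf
  have hright : ∫ u, ∫ x, F (x, u) ∂μ ∂μ =
      ∫ u, (1 / 2 * G) * (u ^ ((1 - β) / 2 - 1) * Real.exp (-(r ^ 2 * u))) ∂μ := by
    refine integral_congr_ae ?_
    filter_upwards [hpos] with u hu using hinner u hu
  rw [← hleft, hswap, hright, houter]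
  have e1 : (1 / r ^ 2) ^ ((1 - β) / 2) = r ^ (β - 1) := by
    rw [one_div, Real.inv_rpow (by positivity), ← Real.rpow_neg (by positivity),
      ← Real.rpow_natCast r 2, ← Real.rpow_mul hr.le]
    congr 1
    push_cast
    ring
  have e2 : G * Real.Gamma ((1 - β) / 2) = Real.pi / Real.cos (Real.pi * β / 2) := by
    have h := Real.Gamma_mul_Gamma_one_sub ((β + 1) / 2)
    rw [show 1 - (β + 1) / 2 = (1 - β) / 2 by ring,
      show Real.pi * ((β + 1) / 2) = Real.pi * β / 2 + Real.pi / 2 by ring,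
      Real.sin_add_pi_div_two] at h
    exact h
  rw [e1]
  calc _ = r ^ (β - 1) * ((G * Real.Gamma ((1 - β) / 2)) / 2) := by ring
    _ = _ := by rw [e2, div_div, mul_comm (Real.cos _)]

theorem integral_abs_rpow_mul_resSym {β : ℝ} (h1 : -1 < β) (h2 : β < 1) {ξ : E3}
    (hr : 0 < rad ξ) : ∫ t : ℝ, |t| ^ β * resSym t ξ =
      rad ξ ^ (β - 1) * (Real.pi / Real.cos (Real.pi * β / 2)) := by
  have h := integral_comp_abs (f := fun x : ℝ => x ^ β * (x ^ 2 + rad ξ ^ 2)⁻¹)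
  simp only [sq_abs] at h
  simp only [resSym, h]
  rw [integral_Ioi_rpow_mul_inv_sq_add_sq h1 h2 hr, mul_comm 2 (Real.cos _), ← div_div]
  ring

theorem integrable_comp_abs {f : ℝ → ℝ} (hf : IntegrableOn f (Set.Ioi 0)) :
    Integrable (fun x => f |x|) := by
  have h := (integrable_indicator_iff measurableSet_Ioi).2 hf
  refine (h.add h.comp_neg).congr ?_
  have h0 : ∀ᵐ x : ℝ, x ≠ 0 := by simp [ae_iff]
  filter_upwards [h0] with x hx
  rcases lt_or_gt_of_ne hx with hx | hx
  · simp [hx, hx.not_gt, abs_of_neg]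
  · simp [hx, hx.not_gt, abs_of_pos]

/-- A function on `ℝ` with an integrable power singularity at `0` and integrable power decay at
infinity is integrable. -/
theorem integrable_of_rpow_bounds {V : Type*} [NormedAddCommGroup V] {f : ℝ → V}
    (hf : AEStronglyMeasurable f) {β A : ℝ} (h1 : -1 < β) (h2 : β < 0)
    (hs : ∀ t, t ≠ 0 → ‖f t‖ ≤ A * |t| ^ β)
    (hl : ∀ t, t ≠ 0 → ‖f t‖ ≤ A * |t| ^ (β - 1)) : Integrable f := by
  -- the first bound is the smaller one near `0`, the second one at infinity
  let g : ℝ → ℝ := fun t => min (t ^ β) (t ^ (β - 1))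
  have hgm : Measurable g := by fun_prop
  have hg : IntegrableOn g (Set.Ioi 0) := by
    rw [← Set.Ioc_union_Ioi_eq_Ioi zero_le_one]
    refine IntegrableOn.union ?_ ?_
    · have hi := (intervalIntegrable_iff_integrableOn_Ioc_of_le zero_le_one).1
        (intervalIntegral.intervalIntegrable_rpow' (a := 0) (b := 1) h1)
      refine hi.mono' hgm.aestronglyMeasurable ?_
      filter_upwards [self_mem_ae_restrict measurableSet_Ioc] with t ht
      have : 0 < t := ht.1
      rw [Real.norm_of_nonneg (le_min (by positivity) (by positivity))]
      exact min_le_left _ _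
    · have hi := integrableOn_Ioi_rpow_of_lt (a := β - 1) (c := 1) (by linarith) one_pos
      refine hi.mono' hgm.aestronglyMeasurable ?_
      filter_upwards [self_mem_ae_restrict measurableSet_Ioi] with t ht
      have : 0 < t := one_pos.trans ht
      rw [Real.norm_of_nonneg (le_min (by positivity) (by positivity))]
      exact min_le_right _ _
  refine ((integrable_comp_abs hg).const_mul A).mono' hf ?_
  have h0 : ∀ᵐ x : ℝ, x ≠ 0 := by simp [ae_iff]
  filter_upwards [h0] with t ht
  simp only [g]
  rcases min_choice (|t| ^ β) (|t| ^ (β - 1)) with h | h <;> rw [h]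
  exacts [hs t ht, hl t ht]

theorem integral_eq_zero_of_odd {V : Type*} [NormedAddCommGroup V] [NormedSpace ℝ V] {f : ℝ → V}
    (hf : ∀ᵐ t, f (-t) = -f t) : ∫ t, f t = 0 := by
  have h : ∫ t, f t = -∫ t, f t := by
    conv_lhs => rw [← integral_neg_eq_self]
    rw [← integral_neg]
    exact integral_congr_ae hf
  have h2 : (2 : ℝ) • ∫ t, f t = 0 := by
    rw [two_smul]
    nth_rewrite 2 [h]
    exact add_neg_cancel _
  exact (smul_eq_zero.1 h2).resolve_left two_ne_zero

/-! ### Bochner integrals in `L²` -/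

/-- A Bochner integral in `L²` can be evaluated pointwise. -/
theorem coeFn_integral_Lp {H : ℝ → Lp ℂ 2 (volume : Measure E3)} (hH : Integrable H)
    {g : ℝ → E3 → ℂ} (hg : Measurable (Function.uncurry g))
    (hHg : ∀ᵐ t, H t =ᵐ[volume] g t) :
    (∫ t, H t : Lp ℂ 2 (volume : Measure E3)) =ᵐ[volume] fun ξ => ∫ t, g t ξ := by
  -- it suffices to compare integrals over sets `A` of finite measure, where Fubini applies
  have key (A : Set E3) (hA : MeasurableSet A) (hA' : volume A < ⊤) :
      Integrable (Function.uncurry g) (volume.prod (volume.restrict A)) := by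
    refine (integrable_prod_iff hg.aestronglyMeasurable).2 ⟨?_, ?_⟩
    · filter_upwards [hHg] with t ht
      exact ((integrableOn_Lp_of_measure_ne_top (H t) (by norm_num) hA'.ne).congr
        (ae_restrict_of_ae ht))
    · refine (hH.norm.const_mul ‖indicatorConstLp 2 hA hA'.ne (1 : ℝ)‖).mono'
        hg.aestronglyMeasurable.norm.integral_prod_right' ?_
      filter_upwards [hHg] with t ht
      rw [Real.norm_of_nonneg (integral_nonneg fun _ => norm_nonneg _)]
      -- `∫_A ‖H t‖` is the inner product of `‖H t‖` with the indicator of `A`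
      let N : Lp ℝ 2 (volume : Measure E3) := (Lp.memLp (H t)).norm.toLp _
      have hN : N =ᵐ[volume] fun ξ => ‖H t ξ‖ := (Lp.memLp (H t)).norm.coeFn_toLp
      have hNn : ‖N‖ ≤ ‖H t‖ := by
        refine Lp.norm_le_norm_of_ae_le ?_
        filter_upwards [hN] with ξ hξ
        rw [hξ, norm_norm]
      have e1 : ∫ ξ in A, ‖Function.uncurry g (t, ξ)‖ =
          inner ℝ (indicatorConstLp 2 hA hA'.ne (1 : ℝ)) N := by
        rw [L2.inner_indicatorConstLp_one]
        refine integral_congr_ae (ae_restrict_of_ae ?_)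
        filter_upwards [ht, hN] with ξ e1 e2
        rw [e2, e1, Function.uncurry_apply_pair]
      rw [e1]
      exact (real_inner_le_norm _ _).trans (mul_le_mul_of_nonneg_left hNn (norm_nonneg _))
  refine ae_eq_of_forall_setIntegral_eq_of_sigmaFinite
    (fun A _ hA' => integrableOn_Lp_of_measure_ne_top _ (by norm_num) hA'.ne)
    (fun A hA hA' => (key A hA hA').integral_prod_right) fun A hA hA' => ?_
  rw [← L2.inner_indicatorConstLp_one (𝕜 := ℂ) hA hA'.ne, ← integral_inner hH,
    ← integral_integral_swap (key A hA hA')]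
  refine integral_congr_ae ?_
  filter_upwards [hHg] with t ht
  rw [L2.inner_indicatorConstLp_one]
  exact integral_congr_ae (ae_restrict_of_ae ht)

/-- The Fourier transform of a component, as a real-linear map on `L²(ℝ³, ℍ)`. -/
def ftComp (k : Fin 4) : L2H →L[ℝ] Lp ℂ 2 (volume : Measure E3) :=
  ((Lp.fourierTransformₗᵢ E3 ℂ).toContinuousLinearEquiv.toContinuousLinearMap.restrictScalars ℝ)
    ∘L (Complex.ofRealCLM ∘L coord k).compLpL 2 (volume : Measure E3)

theorem coeFn_ftComp (k : Fin 4) (v : L2H) : ftComp k v =ᵐ[volume] fun ξ => ccoord k (ft v ξ) := by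
  simp only [ccoord_ft]
  rfl

/-- The Fourier transform of an integral of multipliers is the integral of their symbols. -/
theorem ft_integral {G : ℝ → L2H} (hG : Integrable G) {m : ℝ → E3 → ℝ}
    (hm : Measurable (Function.uncurry m)) (w : L2H)
    (h : ∀ᵐ t, ft (G t) =ᵐ[volume] fun ξ => (m t ξ : ℂ) • ft w ξ) :
    ft (∫ t, G t) =ᵐ[volume] fun ξ => ((∫ t, m t ξ : ℝ) : ℂ) • ft w ξ := by
  have hk (k : Fin 4) : ftComp k (∫ t, G t) =ᵐ[volume]
      fun ξ => ∫ t, (m t ξ : ℂ) * ccoord k (ft w ξ) := by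
    rw [← (ftComp k).integral_comp_comm hG]
    refine coeFn_integral_Lp ((ftComp k).integrable_comp hG)
      (g := fun t ξ => (m t ξ : ℂ) * ccoord k (ft w ξ)) ?_ ?_
    · have h1 : Measurable fun ξ => ccoord k (ft w ξ) := by
        simp only [ccoord_ft]
        exact (Lp.stronglyMeasurable _).measurable
      exact (Complex.measurable_ofReal.comp hm).mul (h1.comp measurable_snd)
    · filter_upwards [h] with t ht
      filter_upwards [coeFn_ftComp k (G t), ht] with ξ e1 e2
      rw [e1, e2, map_smul, smul_eq_mul]
  filter_upwards [ae_all_iff.2 hk, ae_all_iff.2 fun k => coeFn_ftComp k (∫ t, G t)] with ξ e1 e2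
  refine ext_ccoord fun k => ?_
  rw [← e2, e1, integral_mul_const, integral_complex_ofReal, map_smul, smul_eq_mul]

/-! ### The integrand of `f_α(∇)` -/

/-- `(-It)^β = |t|^β (cos(πβ/2) - sgn(t) sin(πβ/2) I)`, where `sgn(t) = |t|⁻¹ t`. -/
theorem qpow_neg_smul {I : ℍ[ℝ]} (hI : I * I = -1) {t : ℝ} (ht : t ≠ 0) {β : ℝ} (hβ : β ≠ 0) :
    qpow (-(t • I)) β = |t| ^ β • ((Real.cos (Real.pi * β / 2) : ℍ[ℝ]) -
      (Real.sin (Real.pi * β / 2) * (|t|⁻¹ * t)) • I) := by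
  have ht' : 0 < |t| := abs_pos.2 ht
  have him : I.im = I := by ext <;> simp [re_eq_zero_of_mul_self hI]
  have him' : (-(t • I)).im = -(t • I) := by ext <;> simp [re_eq_zero_of_mul_self hI]
  have hlog : β • qlog (-(t • I)) =
      ((β * Real.log |t| : ℝ) : ℍ[ℝ]) + (-(Real.pi * β / 2) * (|t|⁻¹ * t)) • I := by
    rw [qlog, re_neg_smul hI, norm_neg_smul hI, zero_div, Real.arccos_zero, him',
      norm_neg_smul hI, smul_add, smul_neg, smul_neg, smul_neg, smul_smul, smul_smul, smul_smul,
      neg_mul, neg_smul]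
    congr 1
    · rw [Quaternion.smul_coe]
    · congr 2
      ring
  have hre : (β • qlog (-(t • I))).re = β * Real.log |t| := by
    rw [hlog]
    simp [re_eq_zero_of_mul_self hI]
  have hq : (β • qlog (-(t • I))).im = (-(Real.pi * β / 2) * (|t|⁻¹ * t)) • I := by
    rw [hlog]
    ext <;> simp [re_eq_zero_of_mul_self hI]
  have hn : ‖(-(Real.pi * β / 2) * (|t|⁻¹ * t)) • I‖ = |Real.pi * β / 2| := by
    rw [norm_smul, norm_eq_one_of_mul_self hI, mul_one, norm_mul, norm_neg, norm_mul,
      Real.norm_eq_abs, Real.norm_eq_abs, Real.norm_eq_abs, abs_inv, abs_abs,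
      inv_mul_cancel₀ ht'.ne', mul_one]
  have hx : Real.pi * β / 2 ≠ 0 := by
    have := Real.pi_ne_zero
    positivity
  have hsin : Real.sin |Real.pi * β / 2| / |Real.pi * β / 2| =
      Real.sin (Real.pi * β / 2) / (Real.pi * β / 2) := by
    rcases abs_choice (Real.pi * β / 2) with h | h <;> rw [h]
    rw [Real.sin_neg, neg_div_neg_eq]
  rw [qpow, Quaternion.exp_eq, hre, hq, hn, Real.cos_abs, hsin, smul_smul, ← Real.exp_eq_exp_ℝ,
    mul_comm β, ← Real.rpow_def_of_pos ht', sub_eq_add_neg, ← neg_smul]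
  congr 3
  field_simp

theorem resLap_real_smul (t r : ℝ) (x : L2H) : resLap t (r • x) = r • resLap t x :=
  (resLap t).toLinearMap.map_smul_of_tower r x

theorem resNabla_real_smul (t r : ℝ) (x : L2H) : resNabla t (r • x) = r • resNabla t x :=
  (resNabla t).toLinearMap.map_smul_of_tower r x

theorem coe_smul_L2H (r : ℝ) (x : L2H) : (r : ℍ[ℝ]) • x = r • x := by
  rw [← algebraMap_smul ℍ[ℝ] r x]
  rfl

theorem neg_one_mul_smul_sub (I : ℍ[ℝ]) (p c s σ : ℝ) :
    -1 * (p • ((c : ℍ[ℝ]) - (s * σ) • I)) =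
      ((-p * c : ℝ) : ℍ[ℝ]) + ((p * (s * σ) : ℝ) : ℍ[ℝ]) * I := by
  rw [Quaternion.coe_mul_eq_smul]
  ext <;> simp <;> ring

theorem smul_mul_add {I : ℍ[ℝ]} (hI : I * I = -1) {t σ a : ℝ} (hσ : σ * t = a) (p c s : ℝ) :
    (t • I) * (((-p * c : ℝ) : ℍ[ℝ]) + ((p * (s * σ) : ℝ) : ℍ[ℝ]) * I) =
      ((-p * (s * a) : ℝ) : ℍ[ℝ]) + ((-p * (c * t) : ℝ) : ℍ[ℝ]) * I := by
  rw [mul_add, Quaternion.coe_mul_eq_smul, Quaternion.coe_mul_eq_smul, Quaternion.mul_coe_eq_smul,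
    smul_mul_smul_comm, hI, smul_smul, ← hσ]
  ext <;> simp <;> first | ring1 | (left; ring1)

theorem coe_add_coe_mul_smul (x y : ℝ) (I : ℍ[ℝ]) (w : L2H) :
    ((x : ℍ[ℝ]) + (y : ℍ[ℝ]) * I) • w = x • w + y • (I • w) := by
  rw [add_smul, mul_smul, coe_smul_L2H, coe_smul_L2H]

theorem smul_add_smul_sub_smul_add_smul {V : Type*} [AddCommGroup V] [Module ℝ V]
    (p c s a t σ : ℝ) (x₁ x₂ x₃ x₄ : V) :
    (-p * (s * a)) • x₁ + (-p * (c * t)) • x₂ - ((-p * c) • x₃ + (p * (s * σ)) • x₄) =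
      (-s) • ((p * a) • x₁) + c • (p • x₃) + ((-c) • ((p * t) • x₂) + (-s) • ((p * σ) • x₄)) := by
  module

/-- `S_L⁻¹(-It, ∇) (-I)² p (c - s sgn(t) I) w`, sorted by the parity of the terms in `t`. -/
theorem leftSResolvent_smul_eq {I : ℍ[ℝ]} (hI : I * I = -1) {t : ℝ} (ht : t ≠ 0)
    (p c s : ℝ) (w : L2H) :
    leftSResolvent (-(t • I)) nabla ((-1 * (p • ((c : ℍ[ℝ]) - (s * (|t|⁻¹ * t)) • I))) • w) =
      (-s) • ((p * |t|) • resLap t w) + c • (p • resNabla t w) +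
        ((-c) • ((p * t) • resLap t (I • w)) +
          (-s) • ((p * (|t|⁻¹ * t)) • resNabla t (I • w))) := by
  have hσ : |t|⁻¹ * t * t = |t| := by
    rw [mul_assoc, ← abs_mul_abs_self t, ← mul_assoc, inv_mul_cancel₀ (abs_ne_zero.2 ht), one_mul]
  have h₁ (x y : ℝ) : resLap t (((x : ℍ[ℝ]) + (y : ℍ[ℝ]) * I) • w) =
      x • resLap t w + y • resLap t (I • w) :=
    (congrArg (resLap t) (coe_add_coe_mul_smul x y I w)).trans <|
      ((resLap t).map_add _ _).trans <| congrArg₂ _ (resLap_real_smul t x w) (resLap_real_smul t y (I • w))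
  have h₂ (x y : ℝ) : resNabla t (((x : ℍ[ℝ]) + (y : ℍ[ℝ]) * I) • w) =
      x • resNabla t w + y • resNabla t (I • w) :=
    (congrArg (resNabla t) (coe_add_coe_mul_smul x y I w)).trans <|
      ((resNabla t).map_add _ _).trans <| congrArg₂ _ (resNabla_real_smul t x w) (resNabla_real_smul t y (I • w))
  have h₃ : (t • I) • ((((-p * c : ℝ) : ℍ[ℝ]) + ((p * (s * (|t|⁻¹ * t)) : ℝ) : ℍ[ℝ]) * I) • w) =
      (((-p * (s * |t|) : ℝ) : ℍ[ℝ]) + ((-p * (c * t) : ℝ) : ℍ[ℝ]) * I) • w :=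
    (mul_smul _ _ w).symm.trans (congrArg (· • w) (smul_mul_add hI hσ p c s))
  rw [neg_one_mul_smul_sub, leftSResolvent_eq hI ht, h₃, h₁, h₂]
  exact smul_add_smul_sub_smul_add_smul _ _ _ _ _ _ _ _ _ _

/-- The integrand splits into two terms that are even in `t`, in which only real scalars occur
besides `∇`, and two terms that are odd in `t`. -/
theorem fAlphaIntegrand_eq {I : ℍ[ℝ]} (hI : I * I = -1) {α : ℝ} (hα : α ≠ 1) (v : nabla.domain)
    {t : ℝ} (ht : t ≠ 0) :
    fAlphaIntegrand α I v t =
      (-Real.sin (Real.pi * (α - 1) / 2)) • (|t| ^ α • resLap t (nabla v)) +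
      Real.cos (Real.pi * (α - 1) / 2) • (|t| ^ (α - 1) • resNabla t (nabla v)) +
      ((-Real.cos (Real.pi * (α - 1) / 2)) • ((|t| ^ (α - 1) * t) • resLap t (I • nabla v)) +
        (-Real.sin (Real.pi * (α - 1) / 2)) •
          ((|t| ^ (α - 1) * (|t|⁻¹ * t)) • resNabla t (I • nabla v))) := by
  have hα' : |t| ^ α = |t| ^ (α - 1) * |t| := by
    rw [← Real.rpow_add_one (abs_ne_zero.2 ht), sub_add_cancel]
  rw [fAlphaIntegrand, neg_mul_neg, hI, qpow_neg_smul hI ht (sub_ne_zero.2 hα), hα']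
  exact leftSResolvent_smul_eq hI ht _ _ _ _

/-! ### Bounds and continuity of the resolvents -/

theorem exists_norm_resolvent_le : ∃ C : ℝ, 0 ≤ C ∧ ∀ t : ℝ, t ≠ 0 → ∀ x : L2H,
    ‖resLap t x‖ ≤ C * (t ^ 2)⁻¹ * ‖x‖ ∧ ‖resNabla t x‖ ≤ C * |t|⁻¹ * ‖x‖ := by
  obtain ⟨C, hC, h⟩ := exists_norm_le_of_sn_ft_le
  refine ⟨3 * C, by positivity, fun t ht x => ⟨?_, ?_⟩⟩
  · have := h (t ^ 2)⁻¹ (by positivity) x (resLap t x) <| by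
      filter_upwards [ft_resLap ht x] with ξ hξ
      rw [hξ, sn_resSym_smul]
      exact mul_le_mul_of_nonneg_right (resSym_le ht ξ) (sn_nonneg _)
    refine this.trans ?_
    gcongr
    linarith
  · have := h (3 * |t|⁻¹) (by positivity) x (resNabla t x) <| by
      filter_upwards [ft_resNabla ht x] with ξ hξ
      rw [hξ, sn_resSym_smul]
      have e1 := mul_le_mul_of_nonneg_left (sn_symD_mul_le ξ (ft x ξ)) (resSym_nonneg t ξ)
      have e2 := mul_le_mul_of_nonneg_right (rad_mul_resSym_le ht ξ) (sn_nonneg (ft x ξ))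
      linarith
    exact this.trans_eq (by ring)

/-- If `|x̂| ≤ K |2πξ| |v̂|` for some `v ∈ L²`, as for `x = ∇v`, then the resolvents applied to `x`
have weaker singularities at `t = 0`. -/
theorem exists_norm_resolvent_le_of_sn_le {x v : L2H} {K : ℝ} (hK : 0 ≤ K)
    (h : ∀ᵐ ξ ∂(volume : Measure E3), sn (ft x ξ) ≤ K * rad ξ * sn (ft v ξ)) :
    ∃ A : ℝ, 0 ≤ A ∧ ∀ t : ℝ, t ≠ 0 → ‖resLap t x‖ ≤ A * |t|⁻¹ ∧ ‖resNabla t x‖ ≤ A := by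
  obtain ⟨C, hC, hCb⟩ := exists_norm_le_of_sn_ft_le
  refine ⟨C * (3 * K) * ‖v‖, by positivity, fun t ht => ⟨?_, ?_⟩⟩
  · have := hCb (K * |t|⁻¹) (by positivity) v (resLap t x) <| by
      filter_upwards [ft_resLap ht x, h] with ξ e1 e2
      rw [e1, sn_resSym_smul]
      have e3 := mul_le_mul_of_nonneg_left e2 (resSym_nonneg t ξ)
      have e4 := mul_le_mul_of_nonneg_right (rad_mul_resSym_le ht ξ)
        (mul_nonneg hK (sn_nonneg (ft v ξ)))
      linarith
    have h0 : 0 ≤ C * K * ‖v‖ * |t|⁻¹ := by positivity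
    linarith
  · refine hCb (3 * K) (by positivity) v (resNabla t x) ?_
    filter_upwards [ft_resNabla ht x, h] with ξ e1 e2
    rw [e1, sn_resSym_smul]
    have e3 := mul_le_mul_of_nonneg_left (sn_symD_mul_le ξ (ft x ξ)) (resSym_nonneg t ξ)
    have e4 := mul_le_mul_of_nonneg_left e2
      (mul_nonneg (resSym_nonneg t ξ) (mul_nonneg zero_le_three (rad_nonneg ξ)))
    have e5 := mul_le_mul_of_nonneg_right (rad_sq_mul_resSym_le t ξ)
      (mul_nonneg (mul_nonneg zero_le_three hK) (sn_nonneg (ft v ξ)))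
    linarith

theorem resSym_sub {s t : ℝ} (hs : s ≠ 0) (ht : t ≠ 0) (ξ : E3) :
    resSym t ξ - resSym s ξ = (s ^ 2 - t ^ 2) * (resSym t ξ * resSym s ξ) := by
  unfold resSym
  have h1 : 0 < t ^ 2 + rad ξ ^ 2 := by positivity
  have h2 : 0 < s ^ 2 + rad ξ ^ 2 := by positivity
  field_simp
  ring

/-- The resolvent identity. -/
theorem resLap_sub {s t : ℝ} (hs : s ≠ 0) (ht : t ≠ 0) (x : L2H) :
    resLap t x - resLap s x = (s ^ 2 - t ^ 2) • resLap t (resLap s x) := by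
  refine eq_of_ft_eq ?_
  filter_upwards [ft_sub (resLap t x) (resLap s x), ft_resLap ht x, ft_resLap hs x,
    ft_real_smul (s ^ 2 - t ^ 2) (resLap t (resLap s x)), ft_resLap ht (resLap s x)]
    with ξ e1 e2 e3 e4 e5
  rw [e1, e2, e3, e4, e5, e3, ← sub_smul, smul_smul, smul_smul, ← Complex.ofReal_sub,
    resSym_sub hs ht]
  push_cast
  ring_nf

theorem resNabla_sub {s t : ℝ} (hs : s ≠ 0) (ht : t ≠ 0) (x : L2H) :
    resNabla t x - resNabla s x = (s ^ 2 - t ^ 2) • resNabla t (resLap s x) := by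
  refine eq_of_ft_eq ?_
  filter_upwards [ft_sub (resNabla t x) (resNabla s x), ft_resNabla ht x, ft_resNabla hs x,
    ft_real_smul (s ^ 2 - t ^ 2) (resNabla t (resLap s x)), ft_resNabla ht (resLap s x),
    ft_resLap hs x] with ξ e1 e2 e3 e4 e5 e6
  rw [e1, e2, e3, e4, e5, e6, ← sub_smul, mul_smul_comm, smul_smul, smul_smul,
    ← Complex.ofReal_sub, resSym_sub hs ht]
  push_cast
  ring_nf

/-- A function of `t ≠ 0` that satisfies a resolvent-type identity is continuous. -/
theorem continuousOn_of_resolvent_identity {f : ℝ → L2H} {b : ℝ → ℝ}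
    (hb : ContinuousOn b {0}ᶜ)
    (h : ∀ s : ℝ, s ≠ 0 → ∃ A, ∀ t : ℝ, t ≠ 0 → ‖f t - f s‖ ≤ |s ^ 2 - t ^ 2| * b t * A) :
    ContinuousOn f {0}ᶜ := by
  intro s hs
  obtain ⟨A, hA⟩ := h s hs
  rw [ContinuousWithinAt, tendsto_iff_norm_sub_tendsto_zero]
  have hc : ContinuousWithinAt (fun t => |s ^ 2 - t ^ 2| * b t * A) {0}ᶜ s := by
    have h1 : ContinuousWithinAt (fun t : ℝ => |s ^ 2 - t ^ 2|) {0}ᶜ s := by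
      have : Continuous fun t : ℝ => |s ^ 2 - t ^ 2| := by fun_prop
      exact this.continuousWithinAt
    exact (h1.mul (hb s hs)).mul continuousWithinAt_const
  have hc' : Filter.Tendsto (fun t => |s ^ 2 - t ^ 2| * b t * A) (nhdsWithin s {0}ᶜ) (nhds 0) := by
    have := hc.tendsto
    simpa using this
  refine squeeze_zero' (Filter.Eventually.of_forall fun t => norm_nonneg _) ?_ hc'
  filter_upwards [self_mem_nhdsWithin] with t ht using hA t ht

theorem continuousOn_resLap (x : L2H) : ContinuousOn (fun t => resLap t x) {0}ᶜ := by
  obtain ⟨C, hC, h⟩ := exists_norm_resolvent_le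
  refine continuousOn_of_resolvent_identity (b := fun t => (t ^ 2)⁻¹) ?_ fun s hs =>
    ⟨C * ‖resLap s x‖, fun t ht => ?_⟩
  · exact ContinuousOn.inv₀ (by fun_prop) fun t ht => pow_ne_zero 2 ht
  · rw [resLap_sub hs ht, norm_smul, Real.norm_eq_abs, mul_assoc]
    exact mul_le_mul_of_nonneg_left (((h t ht (resLap s x)).1).trans_eq (by ring)) (abs_nonneg _)

theorem continuousOn_resNabla (x : L2H) : ContinuousOn (fun t => resNabla t x) {0}ᶜ := by
  obtain ⟨C, hC, h⟩ := exists_norm_resolvent_le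
  refine continuousOn_of_resolvent_identity (b := fun t => |t|⁻¹) ?_ fun s hs =>
    ⟨C * ‖resLap s x‖, fun t ht => ?_⟩
  · exact ContinuousOn.inv₀ (by fun_prop) fun t ht => abs_ne_zero.2 ht
  · rw [resNabla_sub hs ht, norm_smul, Real.norm_eq_abs, mul_assoc]
    exact mul_le_mul_of_nonneg_left (((h t ht (resLap s x)).2).trans_eq (by ring)) (abs_nonneg _)

theorem ae_ne_zero : ∀ᵐ t : ℝ, t ≠ 0 := by simp [ae_iff]

theorem aestronglyMeasurable_of_continuousOn {f : ℝ → L2H} (hf : ContinuousOn f {0}ᶜ) :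
    AEStronglyMeasurable f volume := by
  have h := hf.aestronglyMeasurable (μ := volume) (measurableSet_singleton (0 : ℝ)).compl
  rwa [Measure.restrict_eq_self_of_ae_mem (by filter_upwards [ae_ne_zero] with t ht using ht)] at h

theorem integrable_smul_resLap {x v : L2H} {K : ℝ} (hK : 0 ≤ K)
    (h : ∀ᵐ ξ ∂(volume : Measure E3), sn (ft x ξ) ≤ K * rad ξ * sn (ft v ξ))
    {α : ℝ} (hα₀ : 0 < α) (hα₁ : α < 1) {b : ℝ → ℝ} (hb : Measurable b)
    (hb' : ∀ t, t ≠ 0 → |b t| ≤ |t| ^ α) : Integrable fun t => b t • resLap t x := by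
  obtain ⟨C, hC, h1⟩ := exists_norm_resolvent_le
  obtain ⟨A, hA, h2⟩ := exists_norm_resolvent_le_of_sn_le hK h
  refine integrable_of_rpow_bounds (β := α - 1) (A := A + C * ‖x‖)
    (hb.aestronglyMeasurable.smul (aestronglyMeasurable_of_continuousOn (continuousOn_resLap x)))
    (by linarith) (by linarith) (fun t ht => ?_) fun t ht => ?_
  · have ht' : 0 < |t| := abs_pos.2 ht
    rw [norm_smul, Real.norm_eq_abs, Real.rpow_sub_one ht'.ne']
    have h0 : 0 ≤ C * ‖x‖ * (|t| ^ α / |t|) := by positivity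
    calc |b t| * ‖resLap t x‖ ≤ |t| ^ α * (A * |t|⁻¹) :=
          mul_le_mul (hb' t ht) (h2 t ht).1 (norm_nonneg _) (by positivity)
      _ = A * (|t| ^ α / |t|) := by ring
      _ ≤ _ := by linarith
  · have ht' : 0 < |t| := abs_pos.2 ht
    rw [norm_smul, Real.norm_eq_abs, Real.rpow_sub_one ht'.ne', Real.rpow_sub_one ht'.ne']
    have h0 : 0 ≤ A * (|t| ^ α / |t| / |t|) := by positivity
    calc |b t| * ‖resLap t x‖ ≤ |t| ^ α * (C * (t ^ 2)⁻¹ * ‖x‖) :=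
          mul_le_mul (hb' t ht) (h1 t ht x).1 (norm_nonneg _) (by positivity)
      _ = C * ‖x‖ * (|t| ^ α / |t| / |t|) := by rw [← sq_abs]; ring
      _ ≤ _ := by linarith

theorem integrable_smul_resNabla {x v : L2H} {K : ℝ} (hK : 0 ≤ K)
    (h : ∀ᵐ ξ ∂(volume : Measure E3), sn (ft x ξ) ≤ K * rad ξ * sn (ft v ξ))
    {α : ℝ} (hα₀ : 0 < α) (hα₁ : α < 1) {b : ℝ → ℝ} (hb : Measurable b)
    (hb' : ∀ t, t ≠ 0 → |b t| ≤ |t| ^ (α - 1)) : Integrable fun t => b t • resNabla t x := by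
  obtain ⟨C, hC, h1⟩ := exists_norm_resolvent_le
  obtain ⟨A, hA, h2⟩ := exists_norm_resolvent_le_of_sn_le hK h
  refine integrable_of_rpow_bounds (β := α - 1) (A := A + C * ‖x‖)
    (hb.aestronglyMeasurable.smul (aestronglyMeasurable_of_continuousOn (continuousOn_resNabla x)))
    (by linarith) (by linarith) (fun t ht => ?_) fun t ht => ?_
  · have ht' : 0 < |t| := abs_pos.2 ht
    rw [norm_smul, Real.norm_eq_abs]
    have h0 : 0 ≤ C * ‖x‖ * |t| ^ (α - 1) := by positivity
    calc |b t| * ‖resNabla t x‖ ≤ |t| ^ (α - 1) * A :=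
          mul_le_mul (hb' t ht) (h2 t ht).2 (norm_nonneg _) (by positivity)
      _ ≤ _ := by linarith
  · have ht' : 0 < |t| := abs_pos.2 ht
    rw [norm_smul, Real.norm_eq_abs, Real.rpow_sub_one ht'.ne' (α - 1)]
    have h0 : 0 ≤ A * (|t| ^ (α - 1) / |t|) := by positivity
    calc |b t| * ‖resNabla t x‖ ≤ |t| ^ (α - 1) * (C * |t|⁻¹ * ‖x‖) :=
          mul_le_mul (hb' t ht) (h1 t ht x).2 (norm_nonneg _) (by positivity)
      _ = C * ‖x‖ * (|t| ^ (α - 1) / |t|) := by ring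
      _ ≤ _ := by linarith

/-! ### Convergence of the integral -/

theorem sn_ft_nabla_le (v : nabla.domain) : ∀ᵐ ξ ∂(volume : Measure E3),
    sn (ft (nabla v) ξ) ≤ 3 * rad ξ * sn (ft (v : L2H) ξ) := by
  filter_upwards [ft_nabla v.2] with ξ h
  rw [h]
  exact sn_symD_mul_le ξ _

theorem sn_ft_smul_nabla_le (q : ℍ[ℝ]) (v : nabla.domain) : ∀ᵐ ξ ∂(volume : Measure E3),
    sn (ft (q • nabla v) ξ) ≤ (3 * sn (cplx q)) * rad ξ * sn (ft (v : L2H) ξ) := by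
  filter_upwards [ft_smul q (nabla v), sn_ft_nabla_le v] with ξ h1 h2
  rw [h1]
  refine (sn_mul_le _ _).trans ((mul_le_mul_of_nonneg_left h2 (sn_nonneg _)).trans_eq ?_)
  ring

theorem abs_inv_abs_mul_self {t : ℝ} (ht : t ≠ 0) : |(|t|⁻¹ * t)| = 1 := by
  rw [abs_mul, abs_inv, abs_abs, inv_mul_cancel₀ (abs_ne_zero.2 ht)]

theorem integrable_rpow_resLap {α : ℝ} (hα₀ : 0 < α) (hα₁ : α < 1) (v : nabla.domain) :
    Integrable fun t : ℝ => |t| ^ α • resLap t (nabla v) :=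
  integrable_smul_resLap zero_le_three (sn_ft_nabla_le v) hα₀ hα₁ (by fun_prop) fun t _ => by
    rw [abs_of_nonneg (by positivity)]

theorem integrable_rpow_resNabla {α : ℝ} (hα₀ : 0 < α) (hα₁ : α < 1) (v : nabla.domain) :
    Integrable fun t : ℝ => |t| ^ (α - 1) • resNabla t (nabla v) :=
  integrable_smul_resNabla zero_le_three (sn_ft_nabla_le v) hα₀ hα₁ (by fun_prop) fun t _ => by
    rw [abs_of_nonneg (by positivity)]

theorem integrable_rpow_mul_resLap {α : ℝ} (hα₀ : 0 < α) (hα₁ : α < 1) (q : ℍ[ℝ])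
    (v : nabla.domain) :
    Integrable fun t : ℝ => (|t| ^ (α - 1) * t) • resLap t (q • nabla v) :=
  integrable_smul_resLap (mul_nonneg zero_le_three (sn_nonneg _)) (sn_ft_smul_nabla_le q v)
    hα₀ hα₁ (by fun_prop) fun t ht => by
    have : 0 < |t| := abs_pos.2 ht
    rw [abs_mul, abs_of_nonneg (by positivity : 0 ≤ |t| ^ (α - 1)), Real.rpow_sub_one this.ne',
      div_mul_cancel₀ _ this.ne']

theorem integrable_rpow_mul_resNabla {α : ℝ} (hα₀ : 0 < α) (hα₁ : α < 1) (q : ℍ[ℝ])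
    (v : nabla.domain) :
    Integrable fun t : ℝ => (|t| ^ (α - 1) * (|t|⁻¹ * t)) • resNabla t (q • nabla v) :=
  integrable_smul_resNabla (mul_nonneg zero_le_three (sn_nonneg _)) (sn_ft_smul_nabla_le q v)
    hα₀ hα₁ (by fun_prop) fun t ht => by
    rw [abs_mul, abs_inv_abs_mul_self ht, mul_one, abs_of_nonneg (by positivity)]

theorem resLap_neg (t : ℝ) (x : L2H) : resLap (-t) x = resLap t x := by
  rcases eq_or_ne t 0 with rfl | ht
  · rw [neg_zero]
  refine eq_of_ft_eq ?_
  filter_upwards [ft_resLap ht x, ft_resLap (neg_ne_zero.2 ht) x] with ξ h1 h2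
  rw [h1, h2, resSym, resSym, neg_sq]

theorem resNabla_neg (t : ℝ) (x : L2H) : resNabla (-t) x = resNabla t x := by
  rcases eq_or_ne t 0 with rfl | ht
  · rw [neg_zero]
  refine eq_of_ft_eq ?_
  filter_upwards [ft_resNabla ht x, ft_resNabla (neg_ne_zero.2 ht) x] with ξ h1 h2
  rw [h1, h2, resSym, resSym, neg_sq]

theorem integrable_four_terms {V : Type*} [NormedAddCommGroup V] [NormedSpace ℝ V]
    {f₁ f₂ f₃ f₄ : ℝ → V} (h₁ : Integrable f₁) (h₂ : Integrable f₂) (h₃ : Integrable f₃)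
    (h₄ : Integrable f₄) (a b c d : ℝ) :
    Integrable fun t => a • f₁ t + b • f₂ t + (c • f₃ t + d • f₄ t) :=
  ((h₁.smul a).add (h₂.smul b)).add ((h₃.smul c).add (h₄.smul d))

theorem integral_four_terms {V : Type*} [NormedAddCommGroup V] [NormedSpace ℝ V]
    {f₁ f₂ f₃ f₄ : ℝ → V} (h₁ : Integrable f₁) (h₂ : Integrable f₂) (h₃ : Integrable f₃)
    (h₄ : Integrable f₄) (h₃' : ∀ t, f₃ (-t) = -f₃ t) (h₄' : ∀ t, f₄ (-t) = -f₄ t)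
    (a b c d : ℝ) :
    ∫ t, (a • f₁ t + b • f₂ t + (c • f₃ t + d • f₄ t)) = a • (∫ t, f₁ t) + b • ∫ t, f₂ t := by
  have hodd : ∫ t, (c • f₃ t + d • f₄ t) = 0 := by
    refine integral_eq_zero_of_odd (ae_of_all _ fun t => ?_)
    rw [h₃', h₄', smul_neg, smul_neg, neg_add]
  have h := integral_add ((h₁.smul a).add (h₂.smul b)) ((h₃.smul c).add (h₄.smul d))
  simp only [Pi.add_apply, Pi.smul_apply] at h
  have h' := integral_add (h₁.smul a) (h₂.smul b)
  simp only [Pi.smul_apply] at h'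
  rw [h, hodd, add_zero, h', integral_smul, integral_smul]

theorem fAlphaIntegrand_ae_eq {I : ℍ[ℝ]} (hI : I * I = -1) {α : ℝ} (hα₁ : α < 1)
    (v : nabla.domain) :
    fAlphaIntegrand α I v =ᵐ[volume] fun t =>
      (-Real.sin (Real.pi * (α - 1) / 2)) • (|t| ^ α • resLap t (nabla v)) +
      Real.cos (Real.pi * (α - 1) / 2) • (|t| ^ (α - 1) • resNabla t (nabla v)) +
      ((-Real.cos (Real.pi * (α - 1) / 2)) • ((|t| ^ (α - 1) * t) • resLap t (I • nabla v)) +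
        (-Real.sin (Real.pi * (α - 1) / 2)) •
          ((|t| ^ (α - 1) * (|t|⁻¹ * t)) • resNabla t (I • nabla v))) := by
  filter_upwards [ae_ne_zero] with t ht
  exact fAlphaIntegrand_eq hI hα₁.ne v ht

theorem integrable_fAlphaIntegrand {I : ℍ[ℝ]} (hI : I * I = -1) {α : ℝ} (hα₀ : 0 < α)
    (hα₁ : α < 1) (v : nabla.domain) : Integrable (fAlphaIntegrand α I v) :=
  (integrable_four_terms (integrable_rpow_resLap hα₀ hα₁ v) (integrable_rpow_resNabla hα₀ hα₁ v)
    (integrable_rpow_mul_resLap hα₀ hα₁ I v) (integrable_rpow_mul_resNabla hα₀ hα₁ I v)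
    _ _ _ _).congr (fAlphaIntegrand_ae_eq hI hα₁ v).symm

theorem fAlpha_domain {I : ℍ[ℝ]} (hI : I * I = -1) {α : ℝ} (hα₀ : 0 < α) (hα₁ : α < 1) :
    (fAlpha α I).domain = nabla.domain :=
  le_antisymm (fun _ h => h.fst) fun v h => ⟨h, integrable_fAlphaIntegrand hI hα₀ hα₁ ⟨v, h⟩⟩

/-- The odd terms of the integrand drop out, and with them the imaginary unit `I`. -/
theorem integral_fAlphaIntegrand {I : ℍ[ℝ]} (hI : I * I = -1) {α : ℝ} (hα₀ : 0 < α)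
    (hα₁ : α < 1) (v : nabla.domain) :
    ∫ t, fAlphaIntegrand α I v t =
      Real.cos (Real.pi * α / 2) • (∫ t : ℝ, |t| ^ α • resLap t (nabla v)) +
      Real.cos (Real.pi * (α - 1) / 2) • ∫ t : ℝ, |t| ^ (α - 1) • resNabla t (nabla v) := by
  have h₁ := integrable_rpow_resLap hα₀ hα₁ v
  have h₂ := integrable_rpow_resNabla hα₀ hα₁ v
  have h₃ := integrable_rpow_mul_resLap hα₀ hα₁ I v
  have h₄ := integrable_rpow_mul_resNabla hα₀ hα₁ I v
  have hs : -Real.sin (Real.pi * (α - 1) / 2) = Real.cos (Real.pi * α / 2) := by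
    rw [show Real.pi * (α - 1) / 2 = Real.pi * α / 2 - Real.pi / 2 by ring,
      Real.sin_sub_pi_div_two, neg_neg]
  rw [integral_congr_ae (fAlphaIntegrand_ae_eq hI hα₁ v), ← hs]
  refine integral_four_terms h₁ h₂ h₃ h₄ (fun t => ?_) (fun t => ?_) _ _ _ _
  · rw [abs_neg, resLap_neg, mul_neg, neg_smul]
  · rw [abs_neg, resNabla_neg, mul_neg, mul_neg, neg_smul]

/-! ### The symbol of `f_α(∇)` -/

theorem measurable_resSym_uncurry : Measurable (Function.uncurry resSym) := by
  have : Measurable fun p : ℝ × E3 => rad p.2 := measurable_rad.comp measurable_snd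
  change Measurable fun p : ℝ × E3 => (p.1 ^ 2 + rad p.2 ^ 2)⁻¹
  fun_prop

theorem ft_integral_rpow_resLap {α : ℝ} (hα₀ : 0 < α) (hα₁ : α < 1) (v : nabla.domain) :
    ft (∫ t : ℝ, |t| ^ α • resLap t (nabla v)) =ᵐ[volume] fun ξ =>
      ((rad ξ ^ (α - 1) * (Real.pi / Real.cos (Real.pi * α / 2)) : ℝ) : ℂ) •
        ft (nabla v) ξ := by
  have h := ft_integral (integrable_rpow_resLap hα₀ hα₁ v)
    (m := fun t ξ => |t| ^ α * resSym t ξ) ?_ (nabla v) ?_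
  · filter_upwards [h, ae_rad_pos] with ξ h1 h2
    rw [h1, integral_abs_rpow_mul_resSym (by linarith) hα₁ h2]
  · have h1 : Measurable fun p : ℝ × E3 => |p.1| ^ α := by fun_prop
    exact h1.mul measurable_resSym_uncurry
  · filter_upwards [ae_ne_zero] with t ht
    filter_upwards [ft_real_smul (|t| ^ α) (resLap t (nabla v)), ft_resLap ht (nabla v)]
      with ξ h1 h2
    rw [h1, h2, smul_smul, ← Complex.ofReal_mul]

theorem ft_integral_rpow_resNabla {α : ℝ} (hα₀ : 0 < α) (hα₁ : α < 1) (v : nabla.domain) :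
    ft (∫ t : ℝ, |t| ^ (α - 1) • resNabla t (nabla v)) =ᵐ[volume] fun ξ =>
      ((rad ξ ^ α * (Real.pi / Real.cos (Real.pi * (α - 1) / 2)) : ℝ) : ℂ) •
        ft (v : L2H) ξ := by
  have h := ft_integral (integrable_rpow_resNabla hα₀ hα₁ v)
    (m := fun t ξ => |t| ^ (α - 1) * resSym t ξ * rad ξ ^ 2) ?_ v ?_
  · filter_upwards [h, ae_rad_pos] with ξ h1 h2
    rw [h1, integral_mul_const,
      integral_abs_rpow_mul_resSym (by linarith) (by linarith) h2, mul_right_comm,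
      ← Real.rpow_natCast, ← Real.rpow_add h2, show α - 1 - 1 + ((2 : ℕ) : ℝ) = α by
        push_cast; ring]
  · have h1 : Measurable fun p : ℝ × E3 => |p.1| ^ (α - 1) := by fun_prop
    exact (h1.mul measurable_resSym_uncurry).mul ((measurable_rad.comp measurable_snd).pow_const 2)
  · filter_upwards [ae_ne_zero] with t ht
    filter_upwards [ft_real_smul (|t| ^ (α - 1)) (resNabla t (nabla v)),
      ft_resNabla ht (nabla v), ft_nabla v.2] with ξ h1 h2 h3
    rw [h1, h2, h3, symD_mul_symD_mul, smul_smul, smul_smul, ← Complex.ofReal_mul,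
      ← Complex.ofReal_mul]

/-- The symbol `½ |2πξ|^{α-1} D(ξ) + ½ |2πξ|^α` of `f_α(∇)`, where `D` is the symbol of `∇`. -/
def fSym (α : ℝ) (ξ : E3) : HC :=
  ((1 / 2 * rad ξ ^ (α - 1) : ℝ) : ℂ) • symD ξ + ((1 / 2 * rad ξ ^ α : ℝ) : ℂ) • 1

theorem isSymbol_fSym (α : ℝ) : IsSymbol (fSym α) := by
  have h (β : ℝ) : Measurable fun ξ => 1 / 2 * rad ξ ^ β := by
    have := measurable_rad
    fun_prop
  exact (isSymbol_symD.smul (h _) fun ξ => by rw [rad_neg]).add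
    (isSymbol_one.smul (h _) fun ξ => by rw [rad_neg])

theorem fSym_mul (α : ℝ) (ξ : E3) (x : HC) : fSym α ξ * x =
    ((1 / 2 * rad ξ ^ (α - 1) : ℝ) : ℂ) • (symD ξ * x) +
      ((1 / 2 * rad ξ ^ α : ℝ) : ℂ) • x := by
  rw [fSym, add_mul, smul_mul_assoc, smul_mul_assoc, one_mul]

/-- The factors `π / cos(πβ/2)` of the integrals cancel against the trigonometric coefficients of
the integrand. -/
theorem ft_fAlpha {I : ℍ[ℝ]} (hI : I * I = -1) {α : ℝ} (hα₀ : 0 < α) (hα₁ : α < 1)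
    (v : (fAlpha α I).domain) :
    ft (fAlpha α I v) =ᵐ[volume] fun ξ => fSym α ξ * ft (v : L2H) ξ := by
  obtain ⟨v, hv⟩ := v
  let v' : nabla.domain := ⟨v, hv.fst⟩
  have h0 : fAlpha α I ⟨v, hv⟩ = fAlphaValue α I v' := rfl
  rw [h0, fAlphaValue, integral_fAlphaIntegrand hI hα₀ hα₁]
  set x := ∫ t : ℝ, |t| ^ α • resLap t (nabla v')
  set y := ∫ t : ℝ, |t| ^ (α - 1) • resNabla t (nabla v')
  set c := Real.cos (Real.pi * α / 2) with hc
  set d := Real.cos (Real.pi * (α - 1) / 2) with hd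
  have hπ := Real.pi_pos
  have hc0 : c ≠ 0 := by
    refine (Real.cos_pos_of_mem_Ioo ⟨?_, ?_⟩).ne' <;> nlinarith
  have hd0 : d ≠ 0 := by
    refine (Real.cos_pos_of_mem_Ioo ⟨?_, ?_⟩).ne' <;> nlinarith
  filter_upwards [ft_real_smul (1 / (2 * Real.pi)) (c • x + d • y), ft_add (c • x) (d • y),
    ft_real_smul c x, ft_real_smul d y, ft_integral_rpow_resLap hα₀ hα₁ v',
    ft_integral_rpow_resNabla hα₀ hα₁ v', ft_nabla v'.2] with ξ h1 h2 h3 h4 h5 h6 h7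
  rw [h1, h2, h3, h4, h5, h6, h7, fSym_mul, smul_add, smul_smul, smul_smul, smul_smul, smul_smul,
    ← Complex.ofReal_mul, ← Complex.ofReal_mul, ← Complex.ofReal_mul, ← Complex.ofReal_mul,
    ← hc, ← hd]
  congr 3 <;> field_simp

/-! ### A closed extension -/

theorem rpow_le_one_add_sq {r α : ℝ} (hr : 0 ≤ r) (hα₀ : 0 ≤ α) (hα₂ : α ≤ 2) :
    r ^ α ≤ 1 + r ^ 2 := by
  rcases le_total r 1 with h | h
  · have := Real.rpow_le_one hr h hα₀
    nlinarith [sq_nonneg r]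
  · have := Real.rpow_le_rpow_of_exponent_le h hα₂
    rw [Real.rpow_two] at this
    linarith

theorem sn_fSym_le (α : ℝ) (ξ : E3) : sn (fSym α ξ) ≤ 2 * rad ξ ^ α := by
  have hr := rad_nonneg ξ
  have h1 : rad ξ ^ (α - 1) * rad ξ ≤ rad ξ ^ α := by
    rcases hr.eq_or_lt with h | h
    · rw [← h, mul_zero]
      exact Real.rpow_nonneg le_rfl _
    · rw [Real.rpow_sub_one h.ne', div_mul_cancel₀ _ h.ne']
  refine (sn_add_le _ _).trans ?_
  have hβ (β : ℝ) : 0 ≤ 1 / 2 * rad ξ ^ β := by positivity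
  rw [sn_smul, sn_smul, sn_one, Complex.norm_real, Complex.norm_real,
    Real.norm_of_nonneg (hβ _), Real.norm_of_nonneg (hβ _)]
  have := mul_le_mul_of_nonneg_left (sn_symD_le ξ) (hβ (α - 1))
  linarith

/-- A linear operator `T` has a closed extension if it becomes bounded
after composition with an injective bounded operator `A`. -/
theorem exists_closed_extension {T : Op} (A B : L2H →L[ℍ[ℝ]ᵐᵒᵖ] L2H)
    (hA : ∀ x, A x = 0 → x = 0) (h : ∀ v : T.domain, A (T v) = B v) :
    ∃ S : Op, T ≤ S ∧ IsClosed (S.graph : Set (L2H × L2H)) := by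
  have hclosed : IsClosed {p : L2H × L2H | A p.2 = B p.1} :=
    isClosed_eq (A.continuous.comp continuous_snd) (B.continuous.comp continuous_fst)
  have hsub : (T.graph.topologicalClosure : Set (L2H × L2H)) ⊆ {p | A p.2 = B p.1} := by
    refine closure_minimal ?_ hclosed
    rintro ⟨x, y⟩ hxy
    obtain ⟨hx, rfl⟩ := exists_apply_eq_of_mem_graph hxy
    exact h ⟨x, hx⟩
  have hgraph := Submodule.toLinearPMap_graph_eq T.graph.topologicalClosure <| by
    rintro ⟨x, y⟩ hxy rfl
    refine hA y ?_
    have := hsub hxy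
    rw [Set.mem_ofPred_eq] at this
    exact this.trans B.map_zero
  refine ⟨T.graph.topologicalClosure.toLinearPMap, LinearPMap.le_of_le_graph ?_, ?_⟩
  · rw [hgraph]
    exact T.graph.le_topologicalClosure
  · rw [hgraph]
    exact T.graph.isClosed_topologicalClosure

/-- `(1 - Δ)⁻¹ f_α(∇)` is bounded, since `|2πξ|^α ≤ 1 + |2πξ|²`. -/
theorem exists_closed_extension_fAlpha {I : ℍ[ℝ]} (hI : I * I = -1) {α : ℝ} (hα₀ : 0 < α)
    (hα₁ : α < 1) :
    ∃ T : Op, fAlpha α I ≤ T ∧ IsClosed (T.graph : Set (L2H × L2H)) := by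
  have ha : IsSymbol fun ξ => (resSym 1 ξ : ℂ) • fSym α ξ :=
    (isSymbol_fSym α).smul (measurable_resSym 1) fun ξ => by rw [resSym, resSym, rad_neg]
  obtain ⟨B, hB⟩ := exists_bounded_multiplier ha (K := 2) fun ξ => by
    have hr := rad_nonneg ξ
    have h1 := mul_le_mul_of_nonneg_left (sn_fSym_le α ξ) (resSym_nonneg 1 ξ)
    have h2 : resSym 1 ξ * rad ξ ^ α ≤ 1 := by
      rw [resSym, inv_mul_eq_div, one_pow]
      exact div_le_one_of_le₀ (rpow_le_one_add_sq hr hα₀.le (by linarith)) (by positivity)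
    rw [sn_resSym_smul]
    linarith
  refine exists_closed_extension (resLap 1) B (fun x hx => ?_) fun v => eq_of_ft_eq ?_
  · refine eq_of_ft_eq ?_
    filter_upwards [ft_resLap one_ne_zero x, ft_zero] with ξ h1 h2
    rw [hx, h2] at h1
    have h3 : resSym 1 ξ ≠ 0 := by
      unfold resSym
      positivity
    rw [h2, (smul_eq_zero.1 h1.symm).resolve_left (Complex.ofReal_ne_zero.2 h3)]
  · filter_upwards [ft_resLap one_ne_zero (fAlpha α I v), ft_fAlpha hI hα₀ hα₁ v,
      hB (v : L2H)] with ξ h1 h2 h3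
    rw [h1, h2, h3, smul_mul_assoc]

/-! ### The formula for `f_α(∇)` in terms of fractional powers -/

/-- `f_α(∇) v = (-Δ)^{α/2-1} [½ (-Δ)^{1/2} + ½ ∇] ∇ v` follows from the identity
`|2πξ|^{α-2} (½ |2πξ| + ½ D) D = ½ |2πξ|^{α-1} D + ½ |2πξ|^α` of symbols, as `D² = |2πξ|²`. -/
theorem opComp_apply_eq_of_ft_eq_fSym {α : ℝ} {v x : L2H} (hv : v ∈ negLaplacian.domain)
    (hx : ft x =ᵐ[volume] fun ξ => fSym α ξ * ft v ξ) :
    ∃ h : v ∈ (opComp (fracLaplacian (α / 2 - 1))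
        (opComp ((1 / 2 : ℝ) • fracLaplacian (1 / 2) + (1 / 2 : ℝ) • nabla) nabla)).domain,
      opComp (fracLaplacian (α / 2 - 1))
        (opComp ((1 / 2 : ℝ) • fracLaplacian (1 / 2) + (1 / 2 : ℝ) • nabla) nabla) ⟨v, h⟩ = x := by
  obtain ⟨h1, h2⟩ := nabla_apply_of_mem_negLaplacian hv
  set w := nabla ⟨v, h1⟩
  have hw : ft w =ᵐ[volume] fun ξ => symD ξ * ft v ξ := ft_nabla h1
  have ha : IsSymbol fun ξ => (rad ξ : ℂ) • (1 : HC) := isSymbol_one.smul measurable_rad rad_neg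
  obtain ⟨y, hy⟩ := exists_multiplier ha w (negLaplacian ⟨v, hv⟩) (negLaplacian ⟨v, hv⟩) 3 <| by
    filter_upwards [hw, ft_negLaplacian hv] with ξ e1 e2
    have hr := rad_nonneg ξ
    rw [smul_mul_assoc, one_mul, e1, e2, sn_smul, sn_smul, Complex.norm_real, Complex.norm_real,
      Real.norm_of_nonneg hr, Real.norm_of_nonneg (sq_nonneg _)]
    have h3 := mul_le_mul_of_nonneg_left (sn_symD_mul_le ξ (ft v ξ)) hr
    have h4 := mul_nonneg (sq_nonneg (rad ξ)) (sn_nonneg (ft v ξ))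
    linarith
  obtain ⟨h3, h4⟩ := fracLaplacian_apply_eq (β := 1 / 2) (v := w) (w := y) <| by
    filter_upwards [hy] with ξ e1
    rw [e1, smul_mul_assoc, one_mul, mul_one_div_cancel two_ne_zero, Real.rpow_one]
  have hA : ∃ h : w ∈ ((1 / 2 : ℝ) • fracLaplacian (1 / 2) + (1 / 2 : ℝ) • nabla : Op).domain,
      ((1 / 2 : ℝ) • fracLaplacian (1 / 2) + (1 / 2 : ℝ) • nabla : Op) ⟨w, h⟩ =
        (1 / 2 : ℝ) • y + (1 / 2 : ℝ) • nabla ⟨w, h2⟩ := by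
    refine ⟨⟨h3, h2⟩, ?_⟩
    rw [← h4]
    rfl
  refine opComp_apply_eq (opComp_apply_eq ⟨h1, rfl⟩ hA) (fracLaplacian_apply_eq ?_)
  filter_upwards [ft_add ((1 / 2 : ℝ) • y) ((1 / 2 : ℝ) • nabla ⟨w, h2⟩), ft_real_smul (1 / 2) y,
    ft_real_smul (1 / 2) (nabla ⟨w, h2⟩), hy, ft_nabla h2, hw, hx, ae_rad_pos]
    with ξ e1 e2 e3 e4 e5 e6 e7 hr
  have k1 : rad ξ ^ (2 * (α / 2 - 1)) * (1 / 2 * rad ξ) = 1 / 2 * rad ξ ^ (α - 1) := by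
    rw [show α - 1 = 2 * (α / 2 - 1) + 1 by ring, Real.rpow_add_one hr.ne']
    ring
  have k2 : rad ξ ^ (2 * (α / 2 - 1)) * (1 / 2 * rad ξ ^ 2) = 1 / 2 * rad ξ ^ α := by
    conv_rhs => rw [show α = 2 * (α / 2 - 1) + (2 : ℕ) by push_cast; ring,
      Real.rpow_add_natCast hr.ne']
    ring
  rw [e7, e1, e2, e3, e4, e5, e6, symD_mul_symD_mul, smul_mul_assoc, one_mul, fSym_mul, ← k1, ← k2,
    smul_add, smul_smul, smul_smul, smul_smul, smul_smul, ← Complex.ofReal_mul,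
    ← Complex.ofReal_mul, ← Complex.ofReal_mul, mul_assoc, mul_assoc]

/-! ### The vector part -/

theorem ft_sum {ι : Type*} (s : Finset ι) (f : ι → L2H) :
    ft (∑ i ∈ s, f i) =ᵐ[volume] fun ξ => ∑ i ∈ s, ft (f i) ξ := by
  classical
  induction s using Finset.induction_on with
  | empty =>
    simp only [Finset.sum_empty]
    exact ft_zero
  | insert a s ha ih =>
    rw [Finset.sum_insert ha]
    filter_upwards [ft_add (f a) (∑ i ∈ s, f i), ih] with ξ h1 h2
    rw [h1, h2, Finset.sum_insert ha]

theorem realComp_mem_negLaplacian {v : L2H} (hv : v ∈ negLaplacian.domain) (k : Fin 4) :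
    realComp k v ∈ negLaplacian.domain := by
  refine (negLaplacian_apply_eq (w := realComp k (negLaplacian ⟨v, hv⟩)) ?_).fst
  filter_upwards [ft_realComp k v, ft_realComp k (negLaplacian ⟨v, hv⟩), ft_negLaplacian hv]
    with ξ h1 h2 h3
  rw [h1, h2, h3, map_smul, smul_assoc]

theorem re_symD (ξ : E3) : (symD ξ).re = 0 := by
  have h (a b c d : ℝ) : cplx ⟨a, b, c, d⟩ = ⟨a, b, c, d⟩ := rfl
  simp [symD, Fin.sum_univ_three, e, h]

theorem fSym_sub_re (α : ℝ) (ξ : E3) :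
    fSym α ξ - (fSym α ξ).re • (1 : HC) = ((1 / 2 * rad ξ ^ (α - 1) : ℝ) : ℂ) • symD ξ := by
  have h : (fSym α ξ).re = ((1 / 2 * rad ξ ^ α : ℝ) : ℂ) := by
    rw [fSym, QuaternionAlgebra.re_add, QuaternionAlgebra.re_smul, QuaternionAlgebra.re_smul,
      re_symD, smul_zero, zero_add, QuaternionAlgebra.re_one, smul_eq_mul, mul_one]
  rw [h, fSym, add_sub_cancel_right]

/-- If `A` has the symbol `½ |2πξ|^{α-1} D + ½ |2πξ|^α`, then its vector part has the symbol
`½ |2πξ|^{α-1} D`, because `D` is purely imaginary. -/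
theorem ft_vecPart {A : Op} {α : ℝ} {v : L2H} (hv : ∀ k, realComp k v ∈ A.domain)
    (hA : ∀ u : A.domain, ft (A u) =ᵐ[volume] fun ξ => fSym α ξ * ft (u : L2H) ξ) :
    ft (vecPart A v) =ᵐ[volume] fun ξ =>
      ((1 / 2 * rad ξ ^ (α - 1) : ℝ) : ℂ) • (symD ξ * ft v ξ) := by
  have h (k : Fin 4) :
      ft (MulOpposite.op (basisH k) • imPart (applyOrZero A (realComp k v))) =ᵐ[volume] fun ξ =>
        ((1 / 2 * rad ξ ^ (α - 1) : ℝ) : ℂ) •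
          (symD ξ * (ccoord k (ft v ξ) • cplx (basisH k))) := by
    rw [applyOrZero, dif_pos (hv k)]
    filter_upwards [ft_op_smul (MulOpposite.op (basisH k)) (imPart (A ⟨_, hv k⟩)),
      ft_imPart (A ⟨_, hv k⟩), hA ⟨_, hv k⟩, ft_realComp k v] with ξ h1 h2 h3 h4
    rw [h1, h2, h3, h4, mul_smul_comm, mul_one, QuaternionAlgebra.re_smul, smul_assoc, ← smul_sub,
      fSym_sub_re, smul_mul_assoc, smul_mul_assoc, MulOpposite.unop_op, mul_smul_comm, smul_comm]
  filter_upwards [ft_sum Finset.univ fun k =>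
    MulOpposite.op (basisH k) • imPart (applyOrZero A (realComp k v)), ae_all_iff.2 h] with ξ h1 h2
  refine h1.trans ?_
  simp only [h2]
  rw [← Finset.smul_sum, ← Finset.mul_sum, ← ccoord_basis]

theorem opComp_fracLaplacian_nabla_apply_eq {α : ℝ} {v x : L2H} (hv : v ∈ nabla.domain)
    (hx : ft x =ᵐ[volume] fun ξ => ((1 / 2 * rad ξ ^ (α - 1) : ℝ) : ℂ) • (symD ξ * ft v ξ)) :
    ∃ h : v ∈ (opComp (fracLaplacian ((α - 1) / 2)) nabla).domain,
      x = (1 / 2 : ℝ) • opComp (fracLaplacian ((α - 1) / 2)) nabla ⟨v, h⟩ := by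
  obtain ⟨h1, h2⟩ := opComp_apply_eq (A := fracLaplacian ((α - 1) / 2)) (x := (2 : ℝ) • x)
    ⟨hv, rfl⟩ <| fracLaplacian_apply_eq <| by
      filter_upwards [ft_real_smul 2 x, hx, ft_nabla hv] with ξ e1 e2 e3
      rw [e1, e2, e3, smul_smul, ← Complex.ofReal_mul, mul_div_cancel₀ _ two_ne_zero, ← mul_assoc,
        mul_one_div_cancel two_ne_zero, one_mul]
  exact ⟨h1, by rw [h2, smul_smul, one_div_mul_cancel two_ne_zero, one_smul]⟩

end QNabla

end

open QNabla in
theorem mainTheorem10 (α : ℝ) (hα₀ : 0 < α) (hα₁ : α < 1) (I : ℍ[ℝ]) (hI : I * I = -1) :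
    -- the integrand is meaningful, and the integral converges for every `v ∈ 𝒟(∇)`
    (∀ t : ℝ, t ≠ 0 → -(t • I) ∈ sResolventSet nabla) ∧
    (fAlpha α I).domain = nabla.domain ∧
    -- there is a closed right-linear extension
    (∃ T : Op, fAlpha α I ≤ T ∧ IsClosed (T.graph : Set (L2H × L2H))) ∧
    -- `∇² = -Δ`, in particular `𝒟(∇²) = 𝒟(-Δ)`
    opComp nabla nabla = negLaplacian ∧
    -- `f_α(∇) v = (-Δ)^{α/2-1} [½ (-Δ)^{1/2} + ½ ∇] ∇ v` for `v ∈ 𝒟(-Δ)`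
    (∀ v ∈ negLaplacian.domain,
      ∃ (h₁ : v ∈ (fAlpha α I).domain)
        (h₂ : v ∈ (opComp (fracLaplacian (α / 2 - 1))
          (opComp ((1 / 2 : ℝ) • fracLaplacian (1 / 2) + (1 / 2 : ℝ) • nabla) nabla)).domain),
        fAlpha α I ⟨v, h₁⟩ = opComp (fracLaplacian (α / 2 - 1))
          (opComp ((1 / 2 : ℝ) • fracLaplacian (1 / 2) + (1 / 2 : ℝ) • nabla) nabla) ⟨v, h₂⟩) ∧
    -- `Vec f_α(∇) v = ½ (-Δ)^{(α-1)/2} ∇ v` for `v ∈ 𝒟(-Δ)`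
    (∀ v ∈ negLaplacian.domain,
      (∀ k, realComp k v ∈ (fAlpha α I).domain) ∧
      ∃ h : v ∈ (opComp (fracLaplacian ((α - 1) / 2)) nabla).domain,
        vecPart (fAlpha α I) v =
          (1 / 2 : ℝ) • opComp (fracLaplacian ((α - 1) / 2)) nabla ⟨v, h⟩) := by

  have hdom := fAlpha_domain hI hα₀ hα₁
  refine ⟨fun t ht => ⟨_, isPseudoResolvent_resLap hI ht⟩, hdom,
    exists_closed_extension_fAlpha hI hα₀ hα₁, opComp_nabla_nabla, fun v hv => ?_, fun v hv => ?_⟩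
  · have h₁ : v ∈ (fAlpha α I).domain := hdom ▸ (nabla_apply_of_mem_negLaplacian hv).fst
    obtain ⟨h₂, h⟩ := opComp_apply_eq_of_ft_eq_fSym hv (ft_fAlpha hI hα₀ hα₁ ⟨v, h₁⟩)
    exact ⟨h₁, h₂, h.symm⟩
  · have hk (k : Fin 4) : realComp k v ∈ (fAlpha α I).domain :=
      hdom ▸ (nabla_apply_of_mem_negLaplacian (realComp_mem_negLaplacian hv k)).fst
    exact ⟨hk, opComp_fracLaplacian_nabla_apply_eq (nabla_apply_of_mem_negLaplacian hv).fst
      (ft_vecPart hk (ft_fAlpha hI hα₀ hα₁))⟩
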